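/- **Model.** An instance has agents $N=\{1,\dots,n\}$, projects $M=\{1,\dots,m\}$, project costs $C_j\ge 0$, budgets $b_i\ge 0$, and monotone valuations $v_i:2^M\to\mathbb{R}_{\ge 0}$; write $C(W)=\sum_{j\in W}C_j$. An outcome $(W,x)$ consists of a set $W\subseteq M$ of funded projects and payments $x\in\mathbb{R}^N$. It is feasible if $x_i\le b_i$ for all $i$ and $C(W)\le\sum_{i\in N}x_i$, and it satisfies weak participation (WP) if $v_i(W)-x_i\ge 0$ for all $i$. Its social welfare is $\operatorname{SW}(W,x)=\sum_{i\in N}(v_i(W)-x_i)$. A UWO-WP outcome is one of maximum social welfare among the feasible outcomes that satisfy WP. Valuations are single-minded if for every agent $i$ there are a demand set $D_i\subseteq M$ and a value $z_i\ge 0$ with $v_i(W)=z_i$ if $D_i\subseteq W$ and $v_i(W)=0$ otherwise; they are laminar single-minded if moreover, for all $i,j\in N$, the set $D_i\cap D_j$ is empty or equal to $D_i$ or to $D_j$. **Theorem.** For laminar single-minded valuations, the problem of finding a UWO-WP outcome admits an FPTAS. That is, there are a single algorithm and a polynomial $p$ such that, for every instance $I$ with laminar single-minded valuations, given by $n$,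 $m$, the demand sets $D_i$ and rational numbers $z_i,b_i,C_j\ge 0$ (numerators and denominators in binary), and every real $\varepsilon>0$, the algorithm on input $I$ and $\lceil 1/\varepsilon\rceil$ runs in time at most $p(|I|,1/\varepsilon)$, where $|I|$ is the bit length of $I$, and outputs a feasible outcome $(W,x)$ satisfying WP with $$\operatorname{SW}(W,x)\ \ge\ (1-\varepsilon)\,\operatorname{SW}(W^\star,x^\star),$$ where $(W^\star,x^\star)$ is a UWO-WP outcome of $I$ (one always exists). Running time is measured on a random access machine with logarithmic cost. -/

import Mathlib

/-!
## Participatory budgeting with resource pooling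
-/

/-- An instance with agents `Fin n` and projects `Fin m`: monotone nonnegative valuations on
bundles, nonnegative budgets, nonnegative project costs. -/
structure PBInstance (n m : ℕ) where
  /-- valuation of a bundle by an agent -/
  v : Fin n → Finset (Fin m) → ℝ
  /-- budgets -/
  b : Fin n → ℝ
  /-- project costs -/
  C : Fin m → ℝ
  v_nonneg : ∀ i S, 0 ≤ v i S
  v_mono : ∀ i S T, S ⊆ T → v i S ≤ v i T
  b_nonneg : ∀ i, 0 ≤ b i
  C_nonneg : ∀ j, 0 ≤ C j

/-- A set of funded projects together with the payments of the agents. -/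
structure PBOutcome (n m : ℕ) where
  /-- funded projects -/
  W : Finset (Fin m)
  /-- payments -/
  x : Fin n → ℝ

namespace PBInstance

variable {n m : ℕ}

/-- Total cost of a bundle. -/
def cost (I : PBInstance n m) (S : Finset (Fin m)) : ℝ := ∑ j ∈ S, I.C j

/-- Quasi-linear utility of agent `i`. -/
def utility (I : PBInstance n m) (o : PBOutcome n m) (i : Fin n) : ℝ := I.v i o.W - o.x i

/-- Weak budget balance: the payments cover the cost of the funded projects. -/
def WBB (I : PBInstance n m) (o : PBOutcome n m) : Prop := I.cost o.W ≤ ∑ i, o.x i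

/-- No payment exceeds the budget of the agent, and weak budget balance holds. -/
def Feasible (I : PBInstance n m) (o : PBOutcome n m) : Prop :=
  (∀ i, o.x i ≤ I.b i) ∧ I.WBB o

/-- Weak participation: every agent has nonnegative utility. -/
def WP (I : PBInstance n m) (o : PBOutcome n m) : Prop := ∀ i, 0 ≤ I.utility o i

/-- Utilitarian social welfare. -/
def SW (I : PBInstance n m) (o : PBOutcome n m) : ℝ := ∑ i, I.utility o i

/-- Welfare optimal among the feasible outcomes that satisfy weak participation. -/
def IsUWOWP (I : PBInstance n m) (o : PBOutcome n m) : Prop :=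
  I.Feasible o ∧ I.WP o ∧ ∀ o' : PBOutcome n m, I.Feasible o' → I.WP o' → I.SW o' ≤ I.SW o

end PBInstance

/-- The finite data describing an instance with single-minded valuations: agent `i` has value
`z i` for every bundle that contains the demand set `D i`, and value zero for all others.
The numbers are rational. -/
structure SingleMinded where
  /-- number of agents -/
  n : ℕ
  /-- number of projects -/
  m : ℕ
  /-- demand sets -/
  D : Fin n → Finset (Fin m)
  /-- values of the demand sets -/
  z : Fin n → ℚ≥0
  /-- budgets -/
  b : Fin n → ℚ≥0
  /-- project costs -/
  C : Fin m → ℚ≥0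

namespace SingleMinded

/-- The instance with single-minded valuations described by the data. -/
def toInstance (I : SingleMinded) : PBInstance I.n I.m where
  v i W := if I.D i ⊆ W then (I.z i : ℝ) else 0
  b i := (I.b i : ℝ)
  C j := (I.C j : ℝ)
  v_nonneg i S := by
    split_ifs
    · exact NNRat.cast_nonneg _
    · exact le_rfl
  v_mono i S T h := by
    split_ifs with h1 h2
    · exact le_rfl
    · exact absurd (h1.trans h) h2
    · exact NNRat.cast_nonneg _
    · exact le_rfl
  b_nonneg _ := NNRat.cast_nonneg _
  C_nonneg _ := NNRat.cast_nonneg _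

/-- The demand sets form a laminar family. -/
def Laminar (I : SingleMinded) : Prop :=
  ∀ i j, I.D i ∩ I.D j = ∅ ∨ I.D i ∩ I.D j = I.D i ∨ I.D i ∩ I.D j = I.D j

/-- Number of bits of the binary encoding of a fraction. -/
def bits (q : ℚ≥0) : ℕ := q.num.size + q.den.size

/-- Number of bits of the instance: the numbers of agents and projects, values, budgets and costs
are written in binary, and the demand sets as a 0/1 matrix. -/
def size (I : SingleMinded) : ℕ :=
  I.n.size + I.m.size + I.n * I.m + (∑ i, (bits (I.z i) + bits (I.b i))) + ∑ j, bits (I.C j)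

end SingleMinded

/-!
## Random access machine with logarithmic cost

Structured programs over registers and arrays that hold natural numbers of arbitrary size. Every
operation is charged the bit lengths of the numbers that it involves (operands, result and
addresses), so that the cost is polynomially related to the running time of Turing machines.
-/

namespace RAM

/-- Memory contents: register `x` holds `reg x`, cell `k` of array `a` holds `arr a k`. -/
structure Store where
  /-- registers -/
  reg : ℕ → ℕ
  /-- arrays -/
  arr : ℕ → ℕ → ℕ

/-- Arithmetic expressions; subtraction is truncated, division is rounded down. -/
inductive Exp where
  | lit (k : ℕ)
  | var (x : ℕ)
  | get (a : ℕ) (e : Exp)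
  | add (e f : Exp)
  | sub (e f : Exp)
  | mul (e f : Exp)
  | div (e f : Exp)

/-- Value of an expression. -/
def Exp.eval (s : Store) : Exp → ℕ
  | .lit k => k
  | .var x => s.reg x
  | .get a e => s.arr a (e.eval s)
  | .add e f => e.eval s + f.eval s
  | .sub e f => e.eval s - f.eval s
  | .mul e f => e.eval s * f.eval s
  | .div e f => e.eval s / f.eval s

/-- Logarithmic cost of evaluating an expression: every node of the expression is charged one plus
the bit length of its value. -/
def Exp.cost (s : Store) : Exp → ℕ
  | .lit k => k.size + 1
  | .var x => (s.reg x).size + 1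
  | .get a e => e.cost s + (s.arr a (e.eval s)).size + 1
  | .add e f => e.cost s + f.cost s + (e.eval s + f.eval s).size + 1
  | .sub e f => e.cost s + f.cost s + (e.eval s - f.eval s).size + 1
  | .mul e f => e.cost s + f.cost s + (e.eval s * f.eval s).size + 1
  | .div e f => e.cost s + f.cost s + (e.eval s / f.eval s).size + 1

/-- Programs. -/
inductive Cmd where
  | skip
  /-- write the value of `e` to register `x` -/
  | assign (x : ℕ) (e : Exp)
  /-- write the value of `f` to cell number `e` of array `a` -/
  | put (a : ℕ) (e f : Exp)
  | seq (p q : Cmd)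
  /-- run `p` if `e` is nonzero, and `q` otherwise -/
  | ite (e : Exp) (p q : Cmd)
  /-- repeat `p` as long as `e` is nonzero -/
  | loop (e : Exp) (p : Cmd)

/-- Write to a register. -/
def Store.setReg (s : Store) (x k : ℕ) : Store :=
  { s with reg := Function.update s.reg x k }

/-- Write to a cell of an array. -/
def Store.setArr (s : Store) (a i k : ℕ) : Store :=
  { s with arr := Function.update s.arr a (Function.update (s.arr a) i k) }

/-- `Exec p s t s'`: the program `p`, started in `s`, halts in `s'` after a run of cost `t`. -/
inductive Exec : Cmd → Store → ℕ → Store → Prop where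
  | skip (s : Store) : Exec .skip s 1 s
  | assign (s : Store) (x : ℕ) (e : Exp) :
      Exec (.assign x e) s (e.cost s + 1) (s.setReg x (e.eval s))
  | put (s : Store) (a : ℕ) (e f : Exp) :
      Exec (.put a e f) s (e.cost s + f.cost s + 1) (s.setArr a (e.eval s) (f.eval s))
  | seq {p q : Cmd} {s s₁ s₂ : Store} {t₁ t₂ : ℕ} :
      Exec p s t₁ s₁ → Exec q s₁ t₂ s₂ → Exec (.seq p q) s (t₁ + t₂) s₂
  | ite_true {e : Exp} {p q : Cmd} {s s₁ : Store} {t : ℕ} :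
      e.eval s ≠ 0 → Exec p s t s₁ → Exec (.ite e p q) s (e.cost s + 1 + t) s₁
  | ite_false {e : Exp} {p q : Cmd} {s s₁ : Store} {t : ℕ} :
      e.eval s = 0 → Exec q s t s₁ → Exec (.ite e p q) s (e.cost s + 1 + t) s₁
  | loop_true {e : Exp} {p : Cmd} {s s₁ s₂ : Store} {t₁ t₂ : ℕ} :
      e.eval s ≠ 0 → Exec p s t₁ s₁ → Exec (.loop e p) s₁ t₂ s₂ →
      Exec (.loop e p) s (e.cost s + 1 + t₁ + t₂) s₂
  | loop_false {e : Exp} {p : Cmd} {s : Store} :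
      e.eval s = 0 → Exec (.loop e p) s (e.cost s + 1) s

/-- The array that holds the given values in its first cells and zeros in all others. -/
def ofFin {n : ℕ} (f : Fin n → ℕ) (k : ℕ) : ℕ := if h : k < n then f ⟨k, h⟩ else 0

end RAM

namespace SingleMinded

open RAM

/-- The initial memory for the instance `I` and the accuracy parameter `k`: registers 0, 1, 2 hold
`n`, `m`, `k`; arrays 0 to 5 hold the numerators and denominators of the values, budgets and costs;
cell `i * m + j` of array 6 is 1 if project `j` is in the demand set of agent `i`.
All other registers and cells are 0. -/
def input (I : SingleMinded) (k : ℕ) : Store where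
  reg
    | 0 => I.n
    | 1 => I.m
    | 2 => k
    | _ => 0
  arr
    | 0 => ofFin fun i => (I.z i).num
    | 1 => ofFin fun i => (I.z i).den
    | 2 => ofFin fun i => (I.b i).num
    | 3 => ofFin fun i => (I.b i).den
    | 4 => ofFin fun j => (I.C j).num
    | 5 => ofFin fun j => (I.C j).den
    | 6 => fun p =>
        if ∃ (i : Fin I.n) (j : Fin I.m), p = (i : ℕ) * I.m + (j : ℕ) ∧ j ∈ I.D i then 1 else 0
    | _ => fun _ => 0

/-- The final memory `s` contains the outcome `o`: cell `j` of array 7 is nonzero exactly for the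
funded projects `j`, and the payment of agent `i` is the fraction with numerator in cell `i` of
array 8 and nonzero denominator in cell `i` of array 9. -/
def IsOutput (I : SingleMinded) (s : Store) (o : PBOutcome I.n I.m) : Prop :=
  (∀ j : Fin I.m, j ∈ o.W ↔ s.arr 7 j ≠ 0) ∧
  ∀ i : Fin I.n, s.arr 9 i ≠ 0 ∧ o.x i = (s.arr 8 i : ℝ) / (s.arr 9 i : ℝ)

end SingleMinded

/-!
A bundle is funded by some feasible outcome satisfying WP if and only if its cost is at most the sum
of `min (v i) (b i)` over the agents, and the welfare is largest when exactly the cost is collected.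
The maximal demand sets contained in such a bundle are pairwise disjoint by laminarity. Those whose
cost is at least the value of all demand sets inside them can be dropped, which lowers neither the
welfare nor the surplus of the budgets over the costs. Hence it suffices to choose disjoint demand
sets, each with a positive gain of value over cost, that maximize the sum of the gains subject to a
nonnegative surplus.

If project `j` gets as key the number whose binary digits list the demand sets containing `j`, the
larger sets at the more significant positions, then in the order of the keys every demand set is an
interval. Choosing disjoint demand sets thus becomes interval scheduling: for each prefix of the
projects and each total gain, a dynamic program computes the largest surplus. To make the number of
possible gains polynomial, the largest chosen gain `L` is guessed and the gains are rounded down to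
multiples of `L / (n * k)`, where `k ≥ 1 / ε`; this loses at most `L / k`, an `ε`-fraction of
the sum of the gains.
-/

/-! ### Programs and their running time -/

namespace RAM

namespace Store

@[simp] theorem setReg_reg_self (s : Store) (x k : ℕ) : (s.setReg x k).reg x = k :=
  Function.update_self ..

theorem setReg_reg_of_ne (s : Store) {x y : ℕ} (k : ℕ) (h : y ≠ x) :
    (s.setReg x k).reg y = s.reg y :=
  Function.update_of_ne h ..

@[simp] theorem setReg_arr (s : Store) (x k : ℕ) : (s.setReg x k).arr = s.arr := rfl

@[simp] theorem setArr_reg (s : Store) (a i k : ℕ) : (s.setArr a i k).reg = s.reg := rfl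

theorem setArr_arr (s : Store) (a i k a' i' : ℕ) :
    (s.setArr a i k).arr a' i' = if a' = a ∧ i' = i then k else s.arr a' i' := by
  simp only [setArr, Function.update_apply]
  split_ifs <;> simp_all

/-- The registers below `b` and all arrays have the same contents in both stores. -/
def AgreeBelow (b : ℕ) (s s' : Store) : Prop := (∀ r < b, s'.reg r = s.reg r) ∧ s'.arr = s.arr

theorem AgreeBelow.refl (b : ℕ) (s : Store) : AgreeBelow b s s := ⟨fun _ _ => rfl, rfl⟩

theorem AgreeBelow.trans {b : ℕ} {s s' s'' : Store} (h : AgreeBelow b s s')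
    (h' : AgreeBelow b s' s'') : AgreeBelow b s s'' :=
  ⟨fun r hr => (h'.1 r hr).trans (h.1 r hr), h'.2.trans h.2⟩

theorem AgreeBelow.mono {b c : ℕ} {s s' : Store} (hbc : b ≤ c) (h : AgreeBelow c s s') :
    AgreeBelow b s s' :=
  ⟨fun r hr => h.1 r (hr.trans_le hbc), h.2⟩

theorem AgreeBelow.setReg {b x : ℕ} {s s' : Store} (h : AgreeBelow b s s') (hx : b ≤ x) (k : ℕ) :
    AgreeBelow b s (s'.setReg x k) :=
  ⟨fun r hr => (setReg_reg_of_ne _ _ (hr.trans_le hx).ne).trans (h.1 r hr), h.2⟩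

end Store

open Store

/-- The program `p`, started in `s`, halts after a run of cost at most `T` in a store that satisfies
`Q`. -/
def RunsTo (p : Cmd) (s : Store) (T : ℕ) (Q : Store → Prop) : Prop :=
  ∃ t s', Exec p s t s' ∧ t ≤ T ∧ Q s'

namespace RunsTo

variable {p q : Cmd} {s : Store} {T T' : ℕ} {P Q : Store → Prop}

theorem mono (h : RunsTo p s T P) (hT : T ≤ T') (hPQ : ∀ s', P s' → Q s') : RunsTo p s T' Q :=
  let ⟨t, s', hexec, ht, hP⟩ := h
  ⟨t, s', hexec, ht.trans hT, hPQ s' hP⟩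

theorem assign {x : ℕ} {e : Exp} (hT : e.cost s + 1 ≤ T) (hQ : Q (s.setReg x (e.eval s))) :
    RunsTo (.assign x e) s T Q :=
  ⟨_, _, .assign s x e, hT, hQ⟩

theorem put {a : ℕ} {e f : Exp} (hT : e.cost s + f.cost s + 1 ≤ T)
    (hQ : Q (s.setArr a (e.eval s) (f.eval s))) : RunsTo (.put a e f) s T Q :=
  ⟨_, _, .put s a e f, hT, hQ⟩

theorem seq (hp : RunsTo p s T P) (hq : ∀ s', P s' → RunsTo q s' T' Q) :
    RunsTo (.seq p q) s (T + T') Q :=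
  let ⟨_, s', hexec, ht, hP⟩ := hp
  let ⟨_, s'', hexec', ht', hQ⟩ := hq s' hP
  ⟨_, s'', .seq hexec hexec', Nat.add_le_add ht ht', hQ⟩

theorem loop_false {e : Exp} (he : e.eval s = 0) (hT : e.cost s + 1 ≤ T) (hQ : Q s) :
    RunsTo (.loop e p) s T Q :=
  ⟨_, s, .loop_false he, hT, hQ⟩

theorem loop_true {e : Exp} (he : e.eval s ≠ 0) (hp : RunsTo p s T P)
    (hloop : ∀ s', P s' → RunsTo (.loop e p) s' T' Q) :
    RunsTo (.loop e p) s (e.cost s + 1 + T + T') Q :=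
  let ⟨_, s', hexec, ht, hP⟩ := hp
  let ⟨_, s'', hexec', ht', hQ⟩ := hloop s' hP
  ⟨_, s'', .loop_true he hexec hexec', by omega, hQ⟩

end RunsTo

theorem size_le_self (x : ℕ) : x.size ≤ x := Nat.size_le.2 Nat.lt_two_pow_self

theorem size_add_le (x y : ℕ) : (x + y).size ≤ x.size + y.size + 1 := by
  rw [Nat.size_le, pow_succ]
  have hx : x < 2 ^ (x.size + y.size) :=
    (Nat.lt_size_self x).trans_le (Nat.pow_le_pow_right two_pos (Nat.le_add_right _ _))
  have hy : y < 2 ^ (x.size + y.size) :=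
    (Nat.lt_size_self y).trans_le (Nat.pow_le_pow_right two_pos (Nat.le_add_left _ _))
  omega

theorem size_mul_le (x y : ℕ) : (x * y).size ≤ x.size + y.size := by
  rw [Nat.size_le, pow_add]
  exact Nat.mul_lt_mul'' (Nat.lt_size_self x) (Nat.lt_size_self y)

/-- Repeats `body` as often as register `b` says, with register `b + 1` as the counter. -/
def Cmd.forLoop (b : ℕ) (body : Cmd) : Cmd :=
  .seq (.assign (b + 1) (.lit 0))
    (.loop (.sub (.var b) (.var (b + 1)))
      (.seq body (.assign (b + 1) (.add (.var (b + 1)) (.lit 1)))))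

theorem RunsTo.forLoop {b N T : ℕ} {body : Cmd} {s : Store} {Inv : ℕ → Store → Prop}
    (hN : s.reg b = N) (hzero : Inv 0 (s.setReg (b + 1) 0))
    (hbody : ∀ i < N, ∀ s, Inv i s → s.reg b = N → s.reg (b + 1) = i →
      RunsTo body s T fun s' =>
        Inv (i + 1) (s'.setReg (b + 1) (i + 1)) ∧ s'.reg b = N ∧ s'.reg (b + 1) = i) :
    RunsTo (.forLoop b body) s ((N + 1) * (T + 10 * N + 20)) (Inv N) := by
  have rounds : ∀ d i s, i + d = N → Inv i s → s.reg b = N → s.reg (b + 1) = i →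
      RunsTo (.loop (.sub (.var b) (.var (b + 1)))
        (.seq body (.assign (b + 1) (.add (.var (b + 1)) (.lit 1))))) s
        (d * (T + 10 * N + 20) + (3 * N + 4)) (Inv N) := by
    intro d
    induction d with
    | zero =>
      rintro i s rfl hInv hb hi
      refine loop_false (by simp [Exp.eval, hb, hi]) ?_ hInv
      have := size_le_self i
      simp only [Exp.cost, Exp.eval, hb, hi, add_zero, Nat.sub_self, Nat.size_zero]
      omega
    | succ d ih =>
      intro i s hid hInv hb hi
      have round : RunsTo (.seq body (.assign (b + 1) (.add (.var (b + 1)) (.lit 1)))) s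
          (T + (2 * N + 6)) fun s' => Inv (i + 1) s' ∧ s'.reg b = N ∧ s'.reg (b + 1) = i + 1 := by
        refine (hbody i (by omega) s hInv hb hi).seq fun s₁ ⟨hInv₁, hb₁, hi₁⟩ => assign ?_ ?_
        · have := size_le_self i
          have := size_le_self (i + 1)
          simp only [Exp.cost, Exp.eval, hi₁, Nat.size_one]
          omega
        · simp only [Exp.eval, hi₁, setReg_reg_self, setReg_reg_of_ne _ _ b.lt_succ_self.ne]
          exact ⟨hInv₁, hb₁, trivial⟩
      refine (loop_true (by simp only [Exp.eval, hb, hi]; omega) round fun s' ⟨hInv', hb', hi'⟩ =>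
        ih (i + 1) s' (by omega) hInv' hb' hi').mono ?_ fun _ h => h
      have := size_le_self i
      have := size_le_self N
      have := size_le_self (N - i)
      simp only [Exp.cost, Exp.eval, hb, hi, add_mul, one_mul]
      omega
  refine ((assign (s := s) (Q := fun s' => Inv 0 s' ∧ s'.reg b = N ∧ s'.reg (b + 1) = 0)
    (le_refl 2) ⟨hzero, ?_, setReg_reg_self ..⟩).seq fun s' ⟨hInv, hb, hi⟩ =>
      rounds N 0 s' (zero_add N) hInv hb hi).mono ?_ fun _ h => h
  · rw [setReg_reg_of_ne _ _ b.lt_succ_self.ne, hN]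
  · rw [add_mul, one_mul]
    omega

/-! ### Polynomial-time functions -/

/-- What the machine is started on. -/
structure Query where
  /-- the instance -/
  inst : SingleMinded
  /-- the accuracy parameter -/
  acc : ℕ

/-- The initial memory for the query. -/
def Query.input (q : Query) : Store := q.inst.input q.acc

/-- A number whose contribution to the size of a context is its bit length. -/
structure Word where
  /-- the number -/
  val : ℕ

/-- Types of local variables. An element of `ℕ` stands for a counter and is charged its value, an
element of `Word` is charged its bit length. -/
class LocalVar (β : Type) where
  /-- the number that a register holds for the variable -/
  val : β → ℕ
  /-- the contribution of the variable to the size of a context -/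
  weight : β → ℕ
  size_val_le : ∀ x, (val x).size ≤ weight x

instance : LocalVar ℕ := ⟨id, id, size_le_self⟩

instance : LocalVar Word := ⟨Word.val, fun w => w.val.size, fun _ => le_rfl⟩

/-- Types of contexts in which functions are computed: a query followed by local variables, the
innermost first. -/
class Ctx (α : Type) where
  /-- the underlying query -/
  query : α → Query
  /-- the values of the local variables -/
  locals : α → List ℕ
  /-- the size in which running times are polynomial -/
  meas : α → ℕ
  size_add_acc_le_meas : ∀ a, (query a).inst.size + (query a).acc ≤ meas a

instance : Ctx Query where
  query q := q
  locals _ := []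
  meas q := q.inst.size + q.acc
  size_add_acc_le_meas _ := le_rfl

instance {α β : Type} [Ctx α] [LocalVar β] : Ctx (α × β) where
  query a := Ctx.query a.1
  locals a := LocalVar.val a.2 :: Ctx.locals a.1
  meas a := Ctx.meas a.1 + LocalVar.weight a.2
  size_add_acc_le_meas a := (Ctx.size_add_acc_le_meas a.1).trans (Nat.le_add_right _ _)

open Ctx

variable {α β : Type} [Ctx α] [LocalVar β]

/-- The memory still holds the query of the context, and the registers of the list `l` hold its
local variables. -/
def Holds (l : List ℕ) (s : Store) (a : α) : Prop :=
  (∀ r < 3, s.reg r = (query a).input.reg r) ∧ (∀ c < 7, s.arr c = (query a).input.arr c) ∧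
    l.map s.reg = locals a

theorem Holds.congr {l : List ℕ} {s s' : Store} {a : α} {b : ℕ} (h : Holds l s a) (hb : 3 ≤ b)
    (hl : ∀ r ∈ l, r < b) (hreg : ∀ r < b, s'.reg r = s.reg r)
    (harr : ∀ c < 7, s'.arr c = s.arr c) : Holds l s' a :=
  ⟨fun r hr => (hreg r (hr.trans_le hb)).trans (h.1 r hr),
    fun c hc => (harr c hc).trans (h.2.1 c hc),
    (List.map_congr_left fun r hr => hreg r (hl r hr)).trans h.2.2⟩

theorem Holds.of_agreeBelow {l : List ℕ} {s s' : Store} {a : α} {b : ℕ} (h : Holds l s a)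
    (hb : 3 ≤ b) (hl : ∀ r ∈ l, r < b) (hs : AgreeBelow b s s') : Holds l s' a :=
  h.congr hb hl hs.1 fun c _ => congrFun hs.2 c

theorem Holds.cons {l : List ℕ} {s : Store} {a : α} {r : ℕ} {x : β} (h : Holds l s a)
    (hr : s.reg r = LocalVar.val x) : Holds (r :: l) s (a, x) :=
  ⟨h.1, h.2.1, congrArg₂ List.cons hr h.2.2⟩

theorem Holds.exists_cons {l : List ℕ} {s : Store} {a : α × β} (h : Holds l s a) :
    ∃ r l', l = r :: l' ∧ s.reg r = LocalVar.val a.2 ∧ Holds l' s a.1 :=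
  let ⟨r, l', hl, hr, hl'⟩ := List.map_eq_cons_iff.1 h.2.2
  ⟨r, l', hl, hr, h.1, h.2.1, hl'⟩

/-- The value is bounded by a polynomial in the size of the context. -/
def PolyBdd (g : α → ℕ) : Prop := ∃ K, ∀ a, g a ≤ (meas a + 2) ^ K

namespace PolyBdd

variable {f g : α → ℕ}

theorem mono (hg : PolyBdd g) (h : ∀ a, f a ≤ g a) : PolyBdd f :=
  let ⟨K, hK⟩ := hg
  ⟨K, fun a => (h a).trans (hK a)⟩

theorem const (c : ℕ) : PolyBdd (fun _ : α => c) :=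
  ⟨c, fun _ => (Nat.lt_two_pow_self (n := c)).le.trans
    (Nat.pow_le_pow_left (Nat.le_add_left _ _) _)⟩

theorem meas : PolyBdd (Ctx.meas : α → ℕ) := ⟨1, fun a => by simp⟩

theorem mul (hf : PolyBdd f) (hg : PolyBdd g) : PolyBdd (fun a => f a * g a) :=
  let ⟨K, hK⟩ := hf
  let ⟨L, hL⟩ := hg
  ⟨K + L, fun a => (Nat.mul_le_mul (hK a) (hL a)).trans_eq (pow_add ..).symm⟩

theorem add (hf : PolyBdd f) (hg : PolyBdd g) : PolyBdd (fun a => f a + g a) := by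
  obtain ⟨K, hK⟩ := hf
  obtain ⟨L, hL⟩ := hg
  refine ⟨max K L + 1, fun a => ?_⟩
  calc f a + g a ≤ (Ctx.meas a + 2) ^ max K L + (Ctx.meas a + 2) ^ max K L :=
        Nat.add_le_add ((hK a).trans (Nat.pow_le_pow_right (by omega) (le_max_left ..)))
          ((hL a).trans (Nat.pow_le_pow_right (by omega) (le_max_right ..)))
    _ = (Ctx.meas a + 2) ^ max K L * 2 := (mul_two _).symm
    _ ≤ (Ctx.meas a + 2) ^ (max K L + 1) := Nat.mul_le_mul_left _ (Nat.le_add_left ..)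

theorem comp {γ : Type} [Ctx γ] {f : γ → ℕ} (hf : PolyBdd f) (hg : PolyBdd g) :
    ∃ M : α → ℕ, PolyBdd M ∧ ∀ a c, Ctx.meas c ≤ g a → f c ≤ M a := by
  obtain ⟨K, hK⟩ := hf
  obtain ⟨L, hL⟩ := hg.add (.const 2)
  refine ⟨_, ⟨L * K, fun a => le_rfl⟩, fun a c hc => (hK c).trans ?_⟩
  rw [pow_mul]
  exact Nat.pow_le_pow_left ((Nat.add_le_add_right hc 2).trans (hL a)) K

theorem fst (hg : PolyBdd g) : PolyBdd (fun a : α × β => g a.1) :=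
  let ⟨K, hK⟩ := hg
  ⟨K, fun a => (hK a.1).trans (Nat.pow_le_pow_left
    (Nat.add_le_add_right (Nat.le_add_right _ _) _) _)⟩

theorem size (hf : PolyBdd f) : PolyBdd (fun a => (f a).size) := hf.mono fun _ => size_le_self _

end PolyBdd

/-- The program `p` computes `f` at cost at most `T`: it finds the local variables of the context in
the registers `l` and writes the value to register `b`; it may use the registers above `b` as
scratch memory. -/
def Computes (p : Cmd) (l : List ℕ) (b : ℕ) (f T : α → ℕ) : Prop :=
  ∀ a s, Holds l s a → RunsTo p s (T a) fun s' => s'.reg b = f a ∧ AgreeBelow b s s'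

theorem Computes.forLoop {p : Cmd} {l : List ℕ} {b : ℕ} {c : α → ℕ} {F : α → ℕ → ℕ}
    {step : α → ℕ → ℕ → ℕ} {T : (α × ℕ) × Word → ℕ} {G M : α → ℕ}
    (hp : Computes p ((b + 2) :: (b + 1) :: l) (b + 3)
      (fun q : (α × ℕ) × Word => step q.1.1 q.1.2 q.2.val) T)
    (hT : ∀ a q, meas q ≤ meas a + (c a + G a) → T q ≤ M a)
    (hF : ∀ a i, F a (i + 1) = step a i (F a i)) (hsize : ∀ a, ∀ i ≤ c a, (F a i).size ≤ G a)
    (hb : 3 ≤ b) (hl : ∀ r ∈ l, r < b) {a : α} {s : Store} (hs : Holds l s a)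
    (hcount : s.reg b = c a) (hzero : s.reg (b + 2) = F a 0) :
    RunsTo (.forLoop b (.seq p (.assign (b + 2) (.var (b + 3))))) s
      ((c a + 1) * (M a + (G a + 2) + 10 * c a + 20)) fun s' =>
        s'.reg (b + 2) = F a (c a) ∧ AgreeBelow b s s' := by
  refine RunsTo.forLoop (Inv := fun i s' => s'.reg (b + 2) = F a i ∧ AgreeBelow b s s') hcount
    ⟨(setReg_reg_of_ne _ _ (by omega)).trans hzero, (AgreeBelow.refl b s).setReg b.le_succ 0⟩ ?_
  intro i hi s₁ ⟨hvalue, hagree⟩ hb₁ hi₁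
  have hs₁ : Holds ((b + 2) :: (b + 1) :: l) s₁ ((a, i), Word.mk (F a i)) :=
    ((hs.of_agreeBelow hb hl hagree).cons hi₁).cons hvalue
  have hmeas : meas ((a, i), Word.mk (F a i)) ≤ meas a + (c a + G a) :=
    (add_assoc (meas a) i (F a i).size).trans_le
      (Nat.add_le_add_left (Nat.add_le_add hi.le (hsize a i hi.le)) _)
  refine ((hp _ s₁ hs₁).seq fun s₂ ⟨hvalue₂, hagree₂⟩ => ?_).mono
    (Nat.add_le_add_right (hT a _ hmeas) _) fun _ h => h
  replace hvalue₂ : s₂.reg (b + 3) = F a (i + 1) := hvalue₂.trans (hF a i).symm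
  refine .assign ?_ ⟨⟨?_, ?_⟩, ?_, ?_⟩
  · simpa only [Exp.cost, hvalue₂] using Nat.add_le_add_right (hsize a (i + 1) hi) 2
  · rw [setReg_reg_of_ne _ _ (by omega), setReg_reg_self]
    exact hvalue₂
  · exact ((hagree.trans (hagree₂.mono (by omega))).setReg (by omega) _).setReg (by omega) _
  · rw [setReg_reg_of_ne _ _ (by omega), hagree₂.1 b (by omega), hb₁]
  · rw [setReg_reg_of_ne _ _ (by omega), hagree₂.1 (b + 1) (by omega), hi₁]

/-- Functions that are computed in time polynomial in the size of the context. -/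
def PolyTime (f : α → ℕ) : Prop :=
  PolyBdd (fun a => (f a).size) ∧ ∀ l b, 3 ≤ b → (∀ r ∈ l, r < b) →
    ∃ p T, PolyBdd T ∧ Computes p l b f T

/-- Polynomial-time functions whose values, not just their bit lengths, are polynomially bounded:
the admissible bounds of loops. -/
def Unary (f : α → ℕ) : Prop := PolyTime f ∧ PolyBdd f

namespace PolyTime

variable {f g : α → ℕ}

theorem congr (hf : PolyTime f) (h : ∀ a, f a = g a) : PolyTime g := (funext h : f = g) ▸ hf

theorem of_exp (hs : PolyBdd fun a => (f a).size)
    (h : ∀ l : List ℕ, ∃ (e : Exp) (T : α → ℕ), PolyBdd T ∧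
      ∀ a s, Holds l s a → e.eval s = f a ∧ e.cost s ≤ T a) : PolyTime f := by
  refine ⟨hs, fun l b _ _ => ?_⟩
  obtain ⟨e, T, hT, he⟩ := h l
  refine ⟨.assign b e, fun a => T a + 1, hT.add (.const 1), fun a s hs => ?_⟩
  obtain ⟨heval, hcost⟩ := he a s hs
  exact .assign (Nat.add_le_add_right hcost 1)
    ⟨by simp [heval], (AgreeBelow.refl b s).setReg le_rfl _⟩

theorem const (c : ℕ) : PolyTime (fun _ : α => c) :=
  of_exp (.const _) fun _ => ⟨.lit c, _, .const (c.size + 1), fun _ _ _ => ⟨rfl, le_rfl⟩⟩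

theorem localVar : PolyTime (fun a : α × β => LocalVar.val a.2) := by
  have hs : PolyBdd (fun a : α × β => (LocalVar.val a.2).size) :=
    PolyBdd.meas.mono fun a => (LocalVar.size_val_le a.2).trans (Nat.le_add_left _ _)
  refine of_exp hs fun l => ⟨.var l.head!, _, hs.add (.const 1), fun a s h => ?_⟩
  obtain ⟨r, l', rfl, hr, -⟩ := h.exists_cons
  simp [Exp.eval, Exp.cost, hr]

theorem snd : PolyTime (fun a : α × ℕ => a.2) := localVar

theorem word : PolyTime (fun a : α × Word => a.2.val) := localVar

theorem fst (hf : PolyTime f) : PolyTime (fun a : α × β => f a.1) := by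
  refine ⟨hf.1.fst, fun l b hb hl => ?_⟩
  cases l with
  | nil => exact ⟨.skip, _, .const 0, fun a s h => by simp [Holds, locals] at h⟩
  | cons r l =>
    obtain ⟨p, T, hT, hp⟩ := hf.2 l b hb fun x hx => hl x (List.mem_cons_of_mem _ hx)
    refine ⟨p, fun a => T a.1, hT.fst, fun a s h => ?_⟩
    obtain ⟨r', l', hcons, -, h'⟩ := h.exists_cons
    obtain ⟨rfl, rfl⟩ := List.cons.inj hcons
    exact hp a.1 s h'

theorem unop (hf : PolyTime f) (hg : PolyBdd fun a => (g a).size) (op : Exp → Exp) {T : α → ℕ}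
    (hT : PolyBdd T) (hop : ∀ l s a e, Holds l s a → e.eval s = f a →
      (op e).eval s = g a ∧ (op e).cost s ≤ e.cost s + T a) : PolyTime g := by
  refine ⟨hg, fun l b hb hl => ?_⟩
  obtain ⟨p, Tp, hTp, hp⟩ := hf.2 l b hb hl
  refine ⟨.seq p (.assign b (op (.var b))), fun a => Tp a + ((f a).size + 1 + T a + 1),
    hTp.add (((hf.1.add (.const 1)).add hT).add (.const 1)), fun a s hs => ?_⟩
  refine (hp a s hs).seq fun s₁ ⟨hval, hagree⟩ => ?_
  obtain ⟨heval, hcost⟩ := hop l s₁ a (.var b) (hs.of_agreeBelow hb hl hagree) hval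
  simp only [Exp.cost, hval] at hcost
  exact .assign (Nat.add_le_add_right hcost 1) ⟨by simp [heval], hagree.setReg le_rfl _⟩

theorem binop (hf : PolyTime f) (hg : PolyTime g) (F : ℕ → ℕ → ℕ) (op : Exp → Exp → Exp)
    (hsize : ∀ x y, (F x y).size ≤ x.size + y.size + 1)
    (hop : ∀ s d e, (op d e).eval s = F (d.eval s) (e.eval s) ∧
      (op d e).cost s = d.cost s + e.cost s + (F (d.eval s) (e.eval s)).size + 1) :
    PolyTime (fun a => F (f a) (g a)) := by
  refine ⟨((hf.1.add hg.1).add (.const 1)).mono fun a => hsize _ _, fun l b hb hl => ?_⟩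
  obtain ⟨p, Tp, hTp, hp⟩ := hf.2 l b hb hl
  obtain ⟨q, Tq, hTq, hq⟩ := hg.2 l (b + 1) (by omega) fun r hr => (hl r hr).trans (by omega)
  refine ⟨.seq p (.seq q (.assign b (op (.var b) (.var (b + 1))))),
    fun a => Tp a + (Tq a + (2 * ((f a).size + (g a).size) + 5)),
    hTp.add (hTq.add (((PolyBdd.const 2).mul (hf.1.add hg.1)).add (.const 5))), fun a s hs => ?_⟩
  refine (hp a s hs).seq fun s₁ ⟨hval₁, hagree₁⟩ =>
    (hq a s₁ (hs.of_agreeBelow hb hl hagree₁)).seq fun s₂ ⟨hval₂, hagree₂⟩ => ?_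
  have hb₂ : s₂.reg b = f a := (hagree₂.1 b b.lt_succ_self).trans hval₁
  obtain ⟨heval, hcost⟩ := hop s₂ (.var b) (.var (b + 1))
  simp only [Exp.eval, Exp.cost, hb₂, hval₂] at heval hcost
  have := hsize (f a) (g a)
  exact .assign (by omega) ⟨by simp [heval],
    (hagree₁.trans (hagree₂.mono b.le_succ)).setReg le_rfl _⟩

theorem add (hf : PolyTime f) (hg : PolyTime g) : PolyTime (fun a => f a + g a) :=
  hf.binop hg (· + ·) .add size_add_le fun _ _ _ => ⟨rfl, rfl⟩

theorem sub (hf : PolyTime f) (hg : PolyTime g) : PolyTime (fun a => f a - g a) :=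
  hf.binop hg (· - ·) .sub
    (fun x y => (Nat.size_le_size (Nat.sub_le x y)).trans (by omega)) fun _ _ _ => ⟨rfl, rfl⟩

theorem mul (hf : PolyTime f) (hg : PolyTime g) : PolyTime (fun a => f a * g a) :=
  hf.binop hg (· * ·) .mul
    (fun x y => (size_mul_le x y).trans (by omega)) fun _ _ _ => ⟨rfl, rfl⟩

theorem div (hf : PolyTime f) (hg : PolyTime g) : PolyTime (fun a => f a / g a) :=
  hf.binop hg (· / ·) .div
    (fun x y => (Nat.size_le_size (Nat.div_le_self x y)).trans (by omega)) fun _ _ _ => ⟨rfl, rfl⟩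

/-- The intermediate values have to be polynomially bounded in size, as `n` squarings turn a number
of two bits into one of `2 ^ n` bits. -/
theorem iterate {c : α → ℕ} {F : α → ℕ → ℕ} {step : α → ℕ → ℕ → ℕ} {G : α → ℕ} (hc : Unary c)
    (hzero : PolyTime fun a => F a 0)
    (hstep : PolyTime fun p : (α × ℕ) × Word => step p.1.1 p.1.2 p.2.val)
    (hF : ∀ a i, F a (i + 1) = step a i (F a i)) (hG : PolyBdd G)
    (hsize : ∀ a, ∀ i ≤ c a, (F a i).size ≤ G a) : PolyTime (fun a => F a (c a)) := by
  refine ⟨hG.mono fun a => hsize a _ le_rfl, fun l b hb hl => ?_⟩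
  obtain ⟨pc, Tc, hTc, hpc⟩ := hc.1.2 l b hb hl
  obtain ⟨pi, Ti, hTi, hpi⟩ := hzero.2 l (b + 2) (by omega) fun r hr => (hl r hr).trans (by omega)
  obtain ⟨ps, Ts, hTs, hps⟩ := hstep.2 ((b + 2) :: (b + 1) :: l) (b + 3) (by omega) (by
    simp only [List.mem_cons, forall_eq_or_imp]
    exact ⟨by omega, by omega, fun r hr => (hl r hr).trans (by omega)⟩)
  obtain ⟨M, hM, hTsM⟩ := hTs.comp ((PolyBdd.meas (α := α)).add (hc.2.add hG))
  refine ⟨.seq pc (.seq pi (.seq (.forLoop b (.seq ps (.assign (b + 2) (.var (b + 3)))))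
      (.assign b (.var (b + 2))))),
    fun a => Tc a + (Ti a + ((c a + 1) * (M a + (G a + 2) + 10 * c a + 20) + (G a + 2))),
    hTc.add (hTi.add (((hc.2.add (.const 1)).mul (((hM.add (hG.add (.const 2))).add
      ((PolyBdd.const 10).mul hc.2)).add (.const 20))).add (hG.add (.const 2)))),
    fun a s hs => ?_⟩
  refine (hpc a s hs).seq fun s₁ ⟨hval₁, hagree₁⟩ =>
    (hpi a s₁ (hs.of_agreeBelow hb hl hagree₁)).seq fun s₂ ⟨hval₂, hagree₂⟩ => ?_
  have hss₂ : AgreeBelow b s s₂ := hagree₁.trans (hagree₂.mono (by omega))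
  refine (hps.forLoop hTsM hF hsize hb hl (hs.of_agreeBelow hb hl hss₂)
    ((hagree₂.1 b (by omega)).trans hval₁) hval₂).seq fun s₃ ⟨hval₃, hagree₃⟩ => .assign ?_
      ⟨by simpa [Exp.eval] using hval₃, (hss₂.trans hagree₃).setReg le_rfl _⟩
  simpa only [Exp.cost, hval₃] using Nat.add_le_add_right (hsize a (c a) le_rfl) 2

end PolyTime

end RAM

namespace RAM

open scoped Finset

open Ctx

variable {α β : Type} [Ctx α] [LocalVar β]

theorem PolyBdd.range {c : α → ℕ} {f : α → ℕ → ℕ} (hc : PolyBdd c)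
    (hf : PolyBdd fun p : α × ℕ => f p.1 p.2) :
    ∃ M : α → ℕ, PolyBdd M ∧ ∀ a, ∀ i < c a, f a i ≤ M a := by
  obtain ⟨M, hM, h⟩ := hf.comp ((PolyBdd.meas (α := α)).add hc)
  exact ⟨M, hM, fun a i hi => h a (a, i) (Nat.add_le_add_left hi.le _)⟩

namespace Unary

variable {f g : α → ℕ}

theorem of_le (hf : PolyTime f) (hg : PolyBdd g) (h : ∀ a, f a ≤ g a) : Unary f := ⟨hf, hg.mono h⟩

theorem add (hf : Unary f) (hg : Unary g) : Unary (fun a => f a + g a) :=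
  ⟨hf.1.add hg.1, hf.2.add hg.2⟩

theorem mul (hf : Unary f) (hg : Unary g) : Unary (fun a => f a * g a) :=
  ⟨hf.1.mul hg.1, hf.2.mul hg.2⟩

theorem const (c : ℕ) : Unary (fun _ : α => c) := ⟨.const c, .const c⟩

theorem snd : Unary (fun a : α × ℕ => a.2) :=
  ⟨.snd, PolyBdd.meas.mono fun _ => Nat.le_add_left _ _⟩

theorem fst (hf : Unary f) : Unary (fun a : α × β => f a.1) := ⟨hf.1.fst, hf.2.fst⟩

end Unary

namespace PolyTime

theorem mod {f g : α → ℕ} (hf : PolyTime f) (hg : PolyTime g) : PolyTime (fun a => f a % g a) :=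
  (hf.sub (hg.mul (hf.div hg))).congr fun _ => (Nat.mod_eq_sub_mul_div ..).symm

theorem min {f g : α → ℕ} (hf : PolyTime f) (hg : PolyTime g) :
    PolyTime (fun a => Min.min (f a) (g a)) :=
  (hf.sub (hf.sub hg)).congr fun a => by omega

theorem max {f g : α → ℕ} (hf : PolyTime f) (hg : PolyTime g) :
    PolyTime (fun a => Max.max (f a) (g a)) :=
  (hf.add (hg.sub hf)).congr fun a => by omega

variable {c : α → ℕ} {f : α → ℕ → ℕ}

theorem sum (hc : Unary c) (hf : PolyTime fun p : α × ℕ => f p.1 p.2) :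
    PolyTime (fun a => ∑ i ∈ Finset.range (c a), f a i) := by
  obtain ⟨M, hM, hfM⟩ := PolyBdd.range (f := fun a i => (f a i).size) hc.2 hf.1
  refine iterate (F := fun a j => ∑ i ∈ Finset.range j, f a i)
    (step := fun a i acc => acc + f a i) hc (.const 0) (word.add hf.fst)
    (fun a i => Finset.sum_range_succ (f a) i) (hc.2.size.add (hM.add (.const 1)))
    fun a j hj => ?_
  have hle : ∑ i ∈ Finset.range j, f a i ≤ c a * 2 ^ M a :=
    calc ∑ i ∈ Finset.range j, f a i ≤ #(Finset.range j) • 2 ^ M a :=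
          Finset.sum_le_card_nsmul _ _ _ fun i hi =>
            (Nat.size_le.1 (hfM a i ((Finset.mem_range.1 hi).trans_le hj))).le
      _ ≤ c a * 2 ^ M a := by
          rw [Finset.card_range, smul_eq_mul]
          exact Nat.mul_le_mul_right _ hj
  exact (Nat.size_le_size hle).trans ((size_mul_le _ _).trans_eq (by rw [Nat.size_pow]))

theorem prod (hc : Unary c) (hf : PolyTime fun p : α × ℕ => f p.1 p.2) :
    PolyTime (fun a => ∏ i ∈ Finset.range (c a), f a i) := by
  obtain ⟨M, hM, hfM⟩ := PolyBdd.range (f := fun a i => (f a i).size) hc.2 hf.1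
  refine iterate (F := fun a j => ∏ i ∈ Finset.range j, f a i)
    (step := fun a i acc => acc * f a i) hc (.const 1) (word.mul hf.fst)
    (fun a i => Finset.prod_range_succ (f a) i) ((hM.mul hc.2).add (.const 1)) fun a j hj => ?_
  have hle : ∏ i ∈ Finset.range j, f a i ≤ 2 ^ (M a * c a) :=
    calc ∏ i ∈ Finset.range j, f a i ≤ ∏ _i ∈ Finset.range j, 2 ^ M a :=
          Finset.prod_le_prod' fun i hi =>
            (Nat.size_le.1 (hfM a i ((Finset.mem_range.1 hi).trans_le hj))).le
      _ = 2 ^ (M a * j) := by rw [Finset.prod_const, Finset.card_range, pow_mul]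
      _ ≤ 2 ^ (M a * c a) := Nat.pow_le_pow_right two_pos (Nat.mul_le_mul_left _ hj)
  exact (Nat.size_le_size hle).trans_eq (by rw [Nat.size_pow])

theorem sup (hc : Unary c) (hf : PolyTime fun p : α × ℕ => f p.1 p.2) :
    PolyTime (fun a => (Finset.range (c a)).sup (f a)) := by
  obtain ⟨M, hM, hfM⟩ := PolyBdd.range (f := fun a i => (f a i).size) hc.2 hf.1
  refine iterate (F := fun a j => (Finset.range j).sup (f a))
    (step := fun a i acc => Max.max (f a i) acc) hc (.const 0) (hf.fst.max word)
    (fun a i => by rw [Finset.range_add_one, Finset.sup_insert]) (hM.add (.const 1))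
    fun a j hj => ?_
  have hle : (Finset.range j).sup (f a) ≤ 2 ^ M a := Finset.sup_le fun i hi =>
    (Nat.size_le.1 (hfM a i ((Finset.mem_range.1 hi).trans_le hj))).le
  exact (Nat.size_le_size hle).trans_eq (by rw [Nat.size_pow])

theorem pow {f e : α → ℕ} (hf : PolyTime f) (he : Unary e) : PolyTime (fun a => f a ^ e a) :=
  (prod (f := fun a _ => f a) he hf.fst).congr fun a => by simp

end PolyTime

open Classical in
/-- Predicates that are decided in polynomial time. -/
def PolyDec (P : α → Prop) : Prop := PolyTime (fun a => if P a then 1 else 0)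

theorem PolyTime.ite {P : α → Prop} {_ : DecidablePred P} {f g : α → ℕ} (hP : PolyDec P)
    (hf : PolyTime f) (hg : PolyTime g) : PolyTime (fun a => if P a then f a else g a) :=
  ((hP.mul hf).add (((const 1).sub hP).mul hg)).congr fun a => by by_cases h : P a <;> simp [h]

namespace PolyDec

variable {P R : α → Prop} {f g c : α → ℕ}

theorem congr (hP : PolyDec P) (h : ∀ a, P a ↔ R a) : PolyDec R :=
  (funext fun a => propext (h a) : P = R) ▸ hP

theorem le (hf : PolyTime f) (hg : PolyTime g) : PolyDec (fun a => f a ≤ g a) :=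
  ((PolyTime.const 1).sub (hf.sub hg)).congr fun a => by split_ifs <;> omega

theorem lt (hf : PolyTime f) (hg : PolyTime g) : PolyDec (fun a => f a < g a) :=
  le (hf.add (.const 1)) hg

theorem and (hP : PolyDec P) (hR : PolyDec R) : PolyDec (fun a => P a ∧ R a) :=
  (PolyTime.mul hP hR).congr fun a => by by_cases hP : P a <;> by_cases hR : R a <;> simp [hP, hR]

theorem not (hP : PolyDec P) : PolyDec (fun a => ¬P a) :=
  ((PolyTime.const 1).sub hP).congr fun a => by by_cases hP : P a <;> simp [hP]

theorem imp (hP : PolyDec P) (hR : PolyDec R) : PolyDec (fun a => P a → R a) :=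
  (hP.and hR.not).not.congr fun a => by tauto

theorem eq (hf : PolyTime f) (hg : PolyTime g) : PolyDec (fun a => f a = g a) :=
  ((le hf hg).and (le hg hf)).congr fun _ => le_antisymm_iff.symm

theorem ball {P : α → ℕ → Prop} (hc : Unary c) (hP : PolyDec fun p : α × ℕ => P p.1 p.2) :
    PolyDec (fun a => ∀ i < c a, P a i) := by
  classical
  exact (PolyTime.prod (f := fun a i => if P a i then 1 else 0) hc hP).congr fun a => by
    simp [Finset.prod_ite_zero]

theorem testBit {X i : α → ℕ} (hX : PolyTime X) (hi : Unary i) :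
    PolyDec (fun a => (X a).testBit (i a)) :=
  (eq ((hX.div ((PolyTime.const 2).pow hi)).mod (.const 2)) (.const 1)).congr fun a => by
    rw [Nat.testBit_eq_decide_div_mod_eq, decide_eq_true_iff]

end PolyDec

section Filter

variable {c : α → ℕ} {P : α → ℕ → Prop} [∀ a, DecidablePred (P a)] {f : α → ℕ → ℕ}

theorem PolyTime.sumFilter (hc : Unary c) (hP : PolyDec fun p : α × ℕ => P p.1 p.2)
    (hf : PolyTime fun p : α × ℕ => f p.1 p.2) :
    PolyTime (fun a => ∑ i ∈ Finset.range (c a) with P a i, f a i) :=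
  (sum (f := fun a i => if P a i then f a i else 0) hc
    (.ite (P := fun p : α × ℕ => P p.1 p.2) hP hf (.const 0))).congr fun _ =>
      (Finset.sum_filter ..).symm

theorem PolyTime.supFilter (hc : Unary c) (hP : PolyDec fun p : α × ℕ => P p.1 p.2)
    (hf : PolyTime fun p : α × ℕ => f p.1 p.2) :
    PolyTime (fun a => {i ∈ Finset.range (c a) | P a i}.sup (f a)) :=
  (sup (f := fun a i => if P a i then f a i else 0) hc
    (.ite (P := fun p : α × ℕ => P p.1 p.2) hP hf (.const 0))).congr fun a => by
      rw [Finset.sup_ite]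
      simp

theorem Unary.cardFilter (hc : Unary c) (hP : PolyDec fun p : α × ℕ => P p.1 p.2) :
    Unary (fun a => #{i ∈ Finset.range (c a) | P a i}) :=
  .of_le ((PolyTime.sumFilter hc hP (.const 1)).congr fun _ => (Finset.card_eq_sum_ones _).symm)
    hc.2 fun _ => (Finset.card_filter_le _ _).trans_eq (Finset.card_range _)

end Filter

/-! ### Course-of-values recursion -/

/-- Digit number `u` of `X` in base `B`. -/
def digit (B X u : ℕ) : ℕ := X / B ^ u % B

theorem digit_add_mul_pow_of_lt {B u t : ℕ} (hut : u < t) (X d : ℕ) :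
    digit B (X + d * B ^ t) u = digit B X u := by
  obtain ⟨e, rfl⟩ := Nat.exists_eq_add_of_lt hut
  rcases B.eq_zero_or_pos with rfl | hB
  · simp
  have hpow : d * B ^ (u + e + 1) = d * B ^ e * B * B ^ u := by ring
  rw [digit, digit, hpow, Nat.add_mul_div_right _ _ (Nat.pow_pos hB), Nat.add_mul_mod_self_right]

theorem digit_add_mul_pow_self {B X d t : ℕ} (hX : X < B ^ t) (hd : d < B) :
    digit B (X + d * B ^ t) t = d := by
  rw [digit, Nat.add_mul_div_right _ _ (Nat.zero_lt_of_lt hX), Nat.div_eq_of_lt hX, zero_add,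
    Nat.mod_eq_of_lt hd]

theorem digit_eq_zero_of_lt_pow {B X t u : ℕ} (hB : 0 < B) (hX : X < B ^ t) (htu : t ≤ u) :
    digit B X u = 0 := by
  rw [digit, Nat.div_eq_of_lt (hX.trans_le (Nat.pow_le_pow_right hB htu)), Nat.zero_mod]

/-- The function defined by course-of-values recursion: `g t r` is its value at `t`, where `r` holds
the values below `t`, and zeros from there on. -/
def recTable (g : ℕ → (ℕ → ℕ) → ℕ) (t : ℕ) : ℕ :=
  g t fun u => if u < t then recTable g u else 0
termination_by t

/-- The first `t` values of a function defined by course-of-values recursion, as the digits of a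
number in base `B`. -/
def recCode (B : ℕ) (g : ℕ → (ℕ → ℕ) → ℕ) : ℕ → ℕ
  | 0 => 0
  | t + 1 => recCode B g t + g t (digit B (recCode B g t)) * B ^ t

section recCode

variable {g : ℕ → (ℕ → ℕ) → ℕ} {B c t : ℕ}

theorem recTable_le {Y : ℕ} (hg : ∀ t r M, t < c → (∀ u, r u ≤ M) → g t r ≤ M + Y) (ht : t < c) :
    recTable g t ≤ (t + 1) * Y := by
  induction t using Nat.strong_induction_on with
  | _ t ih =>
    rw [recTable, add_mul, one_mul]
    refine hg t _ _ ht fun u => ?_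
    split_ifs with hut
    · exact (ih u hut (hut.trans ht)).trans (Nat.mul_le_mul_right _ hut)
    · exact Nat.zero_le _

theorem recCode_lt_and_digit (hB : ∀ t < c, recTable g t < B) (ht : t ≤ c) :
    recCode B g t < B ^ t ∧
      digit B (recCode B g t) = fun u => if u < t then recTable g u else 0 := by
  induction t with
  | zero => exact ⟨by simp [recCode], by simp [recCode, digit, funext_iff]⟩
  | succ t ih =>
    obtain ⟨hlt, hdigit⟩ := ih (by omega)
    have hBt : recTable g t < B := hB t ht
    have hcode : recCode B g (t + 1) = recCode B g t + recTable g t * B ^ t := by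
      rw [recTable, ← hdigit, recCode]
    have hlt' : recCode B g (t + 1) < B ^ (t + 1) :=
      calc recCode B g (t + 1) < B ^ t + recTable g t * B ^ t := by omega
        _ = (recTable g t + 1) * B ^ t := by ring
        _ ≤ B ^ (t + 1) := (Nat.mul_le_mul_right _ hBt).trans_eq (pow_succ' ..).symm
    refine ⟨hlt', funext fun u => ?_⟩
    rcases lt_trichotomy u t with hut | rfl | htu
    · rw [hcode, digit_add_mul_pow_of_lt hut, hdigit]
      simp [hut, hut.trans t.lt_succ_self]
    · rw [hcode, digit_add_mul_pow_self hlt hBt, if_pos u.lt_succ_self]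
    · rw [digit_eq_zero_of_lt_pow (Nat.zero_lt_of_lt hBt) hlt' htu, if_neg (by omega)]

end recCode

theorem PolyTime.digit {B X u : α → ℕ} (hB : PolyTime B) (hX : PolyTime X) (hu : Unary u) :
    PolyTime (fun a => RAM.digit (B a) (X a) (u a)) :=
  (hX.div (hB.pow hu)).mod hB

/-- The table computed so far is kept as the digits of one number, as a function has no access to
arrays of its own; `Y` bounds the growth of the values from one step to the next. -/
theorem PolyTime.recTable {c Y u : α → ℕ} {g : α → ℕ → (ℕ → ℕ) → ℕ} (hc : Unary c)
    (hY : PolyTime Y) (hu : PolyTime u) (huc : ∀ a, u a < c a)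
    (hg : ∀ B : α → ℕ, PolyTime B →
      PolyTime fun p : (α × ℕ) × Word => g p.1.1 p.1.2 (RAM.digit (B p.1.1) p.2.val))
    (hgrow : ∀ a t r M, t < c a → (∀ u, r u ≤ M) → g a t r ≤ M + Y a) :
    PolyTime (fun a => RAM.recTable (g a) (u a)) := by
  let B : α → ℕ := fun a => c a * Y a + 1
  have hB : PolyTime B := (hc.1.mul hY).add (.const 1)
  have hlt : ∀ a, ∀ t < c a, RAM.recTable (g a) t < B a := fun a t ht =>
    Nat.lt_succ_of_le ((recTable_le (hgrow a) ht).trans (Nat.mul_le_mul_right _ ht))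
  have hcode : PolyTime (fun a => recCode (B a) (g a) (c a)) :=
    iterate (F := fun a t => recCode (B a) (g a) t)
      (step := fun a t X => X + g a t (RAM.digit (B a) X) * B a ^ t) hc (.const 0)
      (word.add ((hg B hB).mul ((hB.fst.pow .snd).fst))) (fun _ _ => rfl) (hB.pow hc).1
      fun a i hi => Nat.size_le_size ((recCode_lt_and_digit (hlt a) hi).1.le.trans
        (Nat.pow_le_pow_right (Nat.succ_pos _) hi))
  refine (PolyTime.digit hB hcode ⟨hu, hc.2.mono fun a => (huc a).le⟩).congr fun a => ?_
  rw [(recCode_lt_and_digit (hlt a) le_rfl).2]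
  exact if_pos (huc a)

end RAM

/-! ### Input and output -/

namespace SingleMinded

variable (I : SingleMinded)

theorem one_le_bits (q : ℚ≥0) : 1 ≤ bits q :=
  Nat.le_trans (Nat.size_pos.2 (NNRat.den_pos q)) (Nat.le_add_left ..)

theorem agents_le_size : I.n ≤ I.size := by
  have h : ∑ _i : Fin I.n, 1 ≤ ∑ i, (bits (I.z i) + bits (I.b i)) :=
    Finset.sum_le_sum fun i _ => (one_le_bits _).trans (Nat.le_add_right _ _)
  rw [Fin.sum_const, smul_eq_mul, mul_one] at h
  rw [size]
  omega

theorem projects_le_size : I.m ≤ I.size := by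
  have h : ∑ _j : Fin I.m, 1 ≤ ∑ j, bits (I.C j) := Finset.sum_le_sum fun _ _ => one_le_bits _
  rw [Fin.sum_const, smul_eq_mul, mul_one] at h
  rw [size]
  omega

theorem bits_z_add_bits_b_le_size (i : Fin I.n) : bits (I.z i) + bits (I.b i) ≤ I.size := by
  have h := Finset.single_le_sum (f := fun i => bits (I.z i) + bits (I.b i))
    (fun _ _ => Nat.zero_le _) (Finset.mem_univ i)
  rw [size]
  omega

theorem bits_C_le_size (j : Fin I.m) : bits (I.C j) ≤ I.size := by
  have h := Finset.single_le_sum (f := fun j => bits (I.C j)) (fun _ _ => Nat.zero_le _)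
    (Finset.mem_univ j)
  rw [size]
  omega

end SingleMinded

namespace RAM

open Ctx Store

theorem size_ofFin_le {n M : ℕ} {f : Fin n → ℕ} (h : ∀ i, (f i).size ≤ M) (k : ℕ) :
    (ofFin f k).size ≤ M := by
  unfold ofFin
  split_ifs
  · exact h _
  · simp

theorem size_input_arr_le (I : SingleMinded) (k : ℕ) {c : ℕ} (hc : c < 7) (j : ℕ) :
    ((I.input k).arr c j).size ≤ I.size + 1 := by
  have hzb := I.bits_z_add_bits_b_le_size
  have hC := I.bits_C_le_size
  simp only [SingleMinded.bits] at hzb hC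
  interval_cases c
  · exact size_ofFin_le (f := fun i => (I.z i).num) (fun i => by have := hzb i; omega) j
  · exact size_ofFin_le (f := fun i => (I.z i).den) (fun i => by have := hzb i; omega) j
  · exact size_ofFin_le (f := fun i => (I.b i).num) (fun i => by have := hzb i; omega) j
  · exact size_ofFin_le (f := fun i => (I.b i).den) (fun i => by have := hzb i; omega) j
  · exact size_ofFin_le (f := fun i => (I.C i).num) (fun i => by have := hC i; omega) j
  · exact size_ofFin_le (f := fun i => (I.C i).den) (fun i => by have := hC i; omega) j
  · refine le_trans (Nat.size_le.2 ?_) (Nat.le_add_left 1 _)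
    simp only [SingleMinded.input]
    split_ifs <;> simp

variable {α : Type} [Ctx α]

theorem Unary.inputReg {r : ℕ} (hr : r < 3)
    (hle : ∀ q : Query, q.input.reg r ≤ q.inst.size + q.acc) :
    Unary (fun a : α => (query a).input.reg r) := by
  have hb : PolyBdd (fun a : α => (query a).input.reg r) :=
    PolyBdd.meas.mono fun a => (hle _).trans (size_add_acc_le_meas a)
  refine ⟨.of_exp hb.size fun l => ⟨.var r, _, hb.add (.const 1), fun a s hs => ?_⟩, hb⟩
  exact ⟨hs.1 r hr, Nat.add_le_add_right ((size_le_self _).trans_eq (hs.1 r hr)) 1⟩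

theorem Unary.agents : Unary (fun a : α => (query a).inst.n) :=
  inputReg (r := 0) (by omega) fun q => q.inst.agents_le_size.trans (Nat.le_add_right ..)

theorem Unary.projects : Unary (fun a : α => (query a).inst.m) :=
  inputReg (r := 1) (by omega) fun q => q.inst.projects_le_size.trans (Nat.le_add_right ..)

theorem Unary.accuracy : Unary (fun a : α => (query a).acc) :=
  inputReg (r := 2) (by omega) fun _ => Nat.le_add_left ..

theorem PolyTime.inputArr {f : α → ℕ} {c : ℕ} (hc : c < 7) (hf : PolyTime f) :
    PolyTime (fun a => (query a).input.arr c (f a)) := by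
  have hb : PolyBdd (fun a => ((query a).input.arr c (f a)).size) :=
    (PolyBdd.meas.add (.const 1)).mono fun a => (size_input_arr_le _ _ hc _).trans
      (Nat.add_le_add_right ((Nat.le_add_right _ _).trans (size_add_acc_le_meas a)) 1)
  refine hf.unop hb (.get c) (hb.add (.const 1)) fun l s a e hs he => ?_
  simp only [Exp.eval, Exp.cost, he, hs.2.1 c hc, add_assoc, le_refl, and_self]

theorem PolyTime.fill {c : α → ℕ} {f : α → ℕ → ℕ} (hc : Unary c)
    (hf : PolyTime fun p : α × ℕ => f p.1 p.2) {A : ℕ} (hA : 7 ≤ A) {l : List ℕ} {b : ℕ}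
    (hb : 3 ≤ b) (hl : ∀ r ∈ l, r < b) :
    ∃ p T, PolyBdd T ∧ ∀ a s, Holds l s a → RunsTo p s (T a) fun s' =>
      Holds l s' a ∧ (∀ i < c a, s'.arr A i = f a i) ∧ ∀ A' ≠ A, s'.arr A' = s.arr A' := by
  obtain ⟨pc, Tc, hTc, hpc⟩ := hc.1.2 l b hb hl
  obtain ⟨pf, Tf, hTf, hpf⟩ := hf.2 ((b + 1) :: l) (b + 2) (by omega) (by
    simp only [List.mem_cons, forall_eq_or_imp]
    exact ⟨by omega, fun r hr => (hl r hr).trans (by omega)⟩)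
  obtain ⟨M, hM, hTM⟩ := PolyBdd.range (f := fun a i => Tf (a, i)) hc.2 hTf
  obtain ⟨G, hG, hfG⟩ := PolyBdd.range (f := fun a i => (f a i).size) hc.2 hf.1
  refine ⟨.seq pc (.forLoop b (.seq pf (.put A (.var (b + 1)) (.var (b + 2))))),
    fun a => Tc a + (c a + 1) * (M a + (c a + G a + 3) + 10 * c a + 20),
    hTc.add ((hc.2.add (.const 1)).mul (((hM.add ((hc.2.add hG).add (.const 3))).add
      ((PolyBdd.const 10).mul hc.2)).add (.const 20))), fun a s hs => ?_⟩
  refine (hpc a s hs).seq fun s₁ ⟨hcount, hagree⟩ => RunsTo.forLoop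
    (Inv := fun i s' => Holds l s' a ∧ (∀ j < i, s'.arr A j = f a j) ∧
      ∀ A' ≠ A, s'.arr A' = s.arr A') hcount
    ⟨hs.of_agreeBelow hb hl (hagree.setReg b.le_succ 0), by simp, fun A' _ => by
      rw [setReg_arr, hagree.2]⟩ ?_
  intro i hi s₂ ⟨hs₂, hcells, hother⟩ hb₂ hi₂
  refine ((hpf (a, i) s₂ (hs₂.cons hi₂)).seq fun s₃ ⟨hval, hagree₃⟩ => ?_).mono
    (Nat.add_le_add_right (hTM a i hi) _) fun _ h => h
  have hi₃ : s₃.reg (b + 1) = i := (hagree₃.1 _ (by omega)).trans hi₂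
  refine .put ?_ ⟨⟨?_, ?_, ?_⟩, ?_, ?_⟩
  · have hsize := size_le_self i
    have := hfG a i hi
    simp only [Exp.cost, hi₃, hval]
    omega
  all_goals simp only [Exp.eval, hi₃, hval, setReg_arr, setArr_reg]
  · refine hs₂.congr hb hl (fun r hr => ?_) fun c hc => funext fun j => ?_
    · rw [setReg_reg_of_ne _ _ (by omega)]
      exact hagree₃.1 r (by omega)
    · rw [setReg_arr, setArr_arr, if_neg (by omega), hagree₃.2]
  · intro j hj
    rw [setArr_arr, hagree₃.2]
    split_ifs with h
    · rw [h.2]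
    · exact hcells j (by omega)
  · intro A' hA'
    refine (funext fun j => ?_ : _ = s₂.arr A').trans (hother A' hA')
    rw [setArr_arr, if_neg (by tauto), hagree₃.2]
  · exact (hagree₃.1 b (by omega)).trans hb₂

end RAM

/-! ### Laminar families -/

section Laminar

open scoped Finset

variable {ι α : Type*}

/-- Any two of the sets `D i` with `i ∈ N` are disjoint or nested. -/
def LaminarOn (N : Finset ι) (D : ι → Finset α) : Prop :=
  ∀ i ∈ N, ∀ j ∈ N, Disjoint (D i) (D j) ∨ D i ⊆ D j ∨ D j ⊆ D i

theorem LaminarOn.subset {M N : Finset ι} {D : ι → Finset α} (h : LaminarOn N D) (hM : M ⊆ N) :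
    LaminarOn M D :=
  fun i hi j hj => h i (hM hi) j (hM hj)

theorem LaminarOn.exists_pairwiseDisjoint_cover {N : Finset ι} {D : ι → Finset α}
    (h : LaminarOn N D) :
    ∃ M ⊆ N, (M : Set ι).PairwiseDisjoint D ∧ ∀ a ∈ N, ∃ i ∈ M, D a ⊆ D i := by
  classical
  induction N using Finset.induction with
  | empty => exact ⟨∅, by simp⟩
  | insert a N _ ih =>
    obtain ⟨M, hMN, hdisj, hcover⟩ := ih (h.subset (Finset.subset_insert a N))
    by_cases ha : ∃ i ∈ M, D a ⊆ D i
    · exact ⟨M, hMN.trans (Finset.subset_insert a N), hdisj,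
        Finset.forall_mem_insert .. |>.2 ⟨ha, hcover⟩⟩
    push Not at ha
    refine ⟨insert a {i ∈ M | ¬D i ⊆ D a},
      Finset.insert_subset_insert a ((Finset.filter_subset _ _).trans hMN), ?_, ?_⟩
    · rw [Finset.coe_insert]
      refine (hdisj.subset (Finset.coe_subset.2 (Finset.filter_subset _ _))).insert fun i hi _ => ?_
      obtain ⟨hiM, hia⟩ := Finset.mem_filter.1 hi
      have hai := h a (Finset.mem_insert_self a N) i (Finset.mem_insert_of_mem (hMN hiM))
      exact hai.resolve_right (not_or.2 ⟨ha i hiM, hia⟩)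
    · refine Finset.forall_mem_insert .. |>.2 ⟨⟨a, Finset.mem_insert_self .., subset_rfl⟩, ?_⟩
      intro b hb
      obtain ⟨i, hi, hbi⟩ := hcover b hb
      by_cases hia : D i ⊆ D a
      · exact ⟨a, Finset.mem_insert_self .., hbi.trans hia⟩
      · exact ⟨i, Finset.mem_insert_of_mem (Finset.mem_filter.2 ⟨hi, hia⟩), hbi⟩

variable {N : Finset ι} {D : ι → Finset α}

theorem LaminarOn.mem_of_card_le (h : LaminarOn N D) {i a : ι} (hi : i ∈ N) (ha : a ∈ N)
    (hcard : #(D i) ≤ #(D a)) {x y : α} (hx : x ∈ D i) (hy : y ∈ D i) (hxa : x ∈ D a) :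
    y ∈ D a := by
  rcases h i hi a ha with hd | hs | hs
  · exact absurd hxa (Finset.disjoint_left.1 hd hx)
  · exact hs hy
  · rwa [Finset.eq_of_subset_of_card_le hs hcard]

variable [DecidableEq α]

/-- The indices in `N` of the nonempty sets contained in `W`. -/
def containedIn (N : Finset ι) (D : ι → Finset α) (W : Finset α) : Finset ι :=
  {a ∈ N | (D a).Nonempty ∧ D a ⊆ W}

theorem pairwiseDisjoint_containedIn {A : Set ι} (hA : A.PairwiseDisjoint D) :
    A.PairwiseDisjoint fun i => containedIn N D (D i) := by
  intro i hi j hj hij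
  refine Finset.disjoint_left.2 fun a hai haj => ?_
  obtain ⟨-, ⟨x, hx⟩, hai⟩ := Finset.mem_filter.1 hai
  obtain ⟨-, -, haj⟩ := Finset.mem_filter.1 haj
  exact Finset.disjoint_left.1 (hA hi hj hij) (hai hx) (haj hx)

theorem sum_containedIn_le_sum_biUnion {A : Finset ι} (hA : (A : Set ι).PairwiseDisjoint D)
    (f : ι → ℕ) :
    ∑ i ∈ A, ∑ a ∈ containedIn N D (D i), f a ≤ ∑ a ∈ containedIn N D (A.biUnion D), f a := by
  classical
  rw [← Finset.sum_biUnion (pairwiseDisjoint_containedIn hA)]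
  refine Finset.sum_le_sum_of_subset (Finset.biUnion_subset.2 fun i hi => ?_)
  exact Finset.monotone_filter_right _ fun a _ ha =>
    ⟨ha.1, ha.2.trans (Finset.subset_biUnion_of_mem D hi)⟩

theorem LaminarOn.exists_disjoint_sum_containedIn (h : LaminarOn N D) (W : Finset α) :
    ∃ M ⊆ containedIn N D W, (M : Set ι).PairwiseDisjoint D ∧ ∀ f : ι → ℕ,
      ∑ a ∈ containedIn N D W, f a ≤ ∑ i ∈ M, ∑ a ∈ containedIn N D (D i), f a := by
  classical
  obtain ⟨M, hMW, hdisj, hcover⟩ := (h.subset (Finset.filter_subset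
    (fun a => (D a).Nonempty ∧ D a ⊆ W) N)).exists_pairwiseDisjoint_cover
  refine ⟨M, hMW, hdisj, fun f => ?_⟩
  rw [← Finset.sum_biUnion (pairwiseDisjoint_containedIn hdisj)]
  refine Finset.sum_le_sum_of_subset fun a ha => ?_
  obtain ⟨i, hi, hai⟩ := hcover a ha
  obtain ⟨haN, hane, -⟩ := Finset.mem_filter.1 ha
  exact Finset.mem_biUnion.2 ⟨i, hi, Finset.mem_filter.2 ⟨haN, hane, hai⟩⟩

/-! ### Ordering the ground set so that the sets become intervals -/

theorem testBit_sum_two_pow (s : Finset ℕ) (j : ℕ) : (∑ i ∈ s, 2 ^ i).testBit j ↔ j ∈ s := by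
  rw [← Nat.mem_bitIndices, ← List.mem_toFinset, Finset.toFinset_bitIndices_sum_two_pow]

/-- The characteristic vector of the sets that contain `x`, read as a binary number whose leading
digits belong to the sets of largest rank. -/
def sortKey (N : Finset ι) (D : ι → Finset α) (rank : ι → ℕ) (x : α) : ℕ :=
  ∑ i ∈ N with x ∈ D i, 2 ^ rank i

variable {rank : ι → ℕ}

theorem testBit_sortKey (hinj : Set.InjOn rank N) (x : α) (e : ℕ) :
    (sortKey N D rank x).testBit e ↔ ∃ i ∈ N, x ∈ D i ∧ rank i = e := by
  have hinj' : Set.InjOn rank ({i ∈ N | x ∈ D i} : Finset ι) :=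
    hinj.mono (Finset.coe_subset.2 (Finset.filter_subset _ _))
  rw [sortKey, ← Finset.sum_image (f := fun e => 2 ^ e) hinj', testBit_sum_two_pow]
  simp only [Finset.mem_image, Finset.mem_filter, and_assoc]

theorem LaminarOn.sortKey_div_eq (h : LaminarOn N D) (hinj : Set.InjOn rank N)
    (hrank : ∀ i ∈ N, ∀ j ∈ N, rank i ≤ rank j → #(D i) ≤ #(D j)) {i : ι} (hi : i ∈ N) {c : ℕ}
    (hc : rank i ≤ c) {x y : α} (hx : x ∈ D i) (hy : y ∈ D i) :
    sortKey N D rank x / 2 ^ c = sortKey N D rank y / 2 ^ c := by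
  refine Nat.eq_of_testBit_eq fun e => Bool.eq_iff_iff.2 ?_
  rw [Nat.testBit_div_two_pow, Nat.testBit_div_two_pow, testBit_sortKey hinj, testBit_sortKey hinj]
  refine exists_congr fun a => and_congr_right fun ha => and_congr_left fun hae => ?_
  have hcard := hrank i hi a ha (by omega)
  exact ⟨h.mem_of_card_le hi ha hcard hx hy, h.mem_of_card_le hi ha hcard hy hx⟩

theorem LaminarOn.sortKey_separates (h : LaminarOn N D) (hinj : Set.InjOn rank N)
    (hrank : ∀ i ∈ N, ∀ j ∈ N, rank i ≤ rank j → #(D i) ≤ #(D j)) {i j : ι} (hi : i ∈ N)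
    (hj : j ∈ N) (hd : Disjoint (D i) (D j)) :
    (∀ x ∈ D i, ∀ y ∈ D j, sortKey N D rank x < sortKey N D rank y) ∨
      ∀ y ∈ D j, ∀ x ∈ D i, sortKey N D rank y < sortKey N D rank x := by
  wlog hle : rank j ≤ rank i generalizing i j
  · exact (this hj hi hd.symm (by omega)).symm
  rcases (D i).eq_empty_or_nonempty with he | ⟨x₀, hx₀⟩
  · simp [he]
  rcases (D j).eq_empty_or_nonempty with he | ⟨y₀, hy₀⟩
  · simp [he]
  set B := 2 ^ rank i
  have hx : ∀ x ∈ D i, sortKey N D rank x / B = sortKey N D rank x₀ / B :=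
    fun x hx => h.sortKey_div_eq hinj hrank hi le_rfl hx hx₀
  have hy : ∀ y ∈ D j, sortKey N D rank y / B = sortKey N D rank y₀ / B :=
    fun y hy => h.sortKey_div_eq hinj hrank hj hle hy hy₀
  have hne : sortKey N D rank x₀ / B ≠ sortKey N D rank y₀ / B := by
    intro heq
    have hbit : (sortKey N D rank x₀ / B).testBit 0 := by
      rw [Nat.testBit_div_two_pow, zero_add]
      exact (testBit_sortKey hinj ..).2 ⟨i, hi, hx₀, rfl⟩
    rw [heq, Nat.testBit_div_two_pow, zero_add, testBit_sortKey hinj] at hbit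
    obtain ⟨a, ha, hya, hai⟩ := hbit
    exact Finset.disjoint_left.1 hd (hinj ha hi hai ▸ hya) hy₀
  refine hne.lt_or_gt.imp (fun hlt x hxi y hyj => ?_) fun hlt y hyj x hxi => ?_
  all_goals
    rw [← hx x hxi, ← hy y hyj] at hlt
    exact lt_of_not_ge fun hge => hlt.not_ge (Nat.div_le_div_right hge)

end Laminar

section Intervals

open scoped Finset

variable {α β : Type*} [LinearOrder β] {κ : α → β} {U S T : Finset α}

/-- The number of elements of `U` that precede `S` in the order given by `κ`. -/
def cardBefore (κ : α → β) (U S : Finset α) : ℕ := #{x ∈ U | ∀ y ∈ S, κ x < κ y}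

/-- The number of elements of `U` up to the last element of `S` in the order given by `κ`. -/
def cardUpTo (κ : α → β) (U S : Finset α) : ℕ := #{x ∈ U | ∃ y ∈ S, κ x ≤ κ y}

theorem cardUpTo_le_card : cardUpTo κ U S ≤ #U := Finset.card_filter_le _ _

theorem cardUpTo_le_cardBefore (h : ∀ x ∈ S, ∀ y ∈ T, κ x < κ y) :
    cardUpTo κ U S ≤ cardBefore κ U T :=
  Finset.card_le_card <| Finset.monotone_filter_right _ fun _ _ ⟨y, hy, hxy⟩ z hz =>
    hxy.trans_lt (h y hy z hz)

theorem cardBefore_lt_cardUpTo (hS : S ⊆ U) {x : α} (hxS : x ∈ S) (hxT : x ∈ T) :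
    cardBefore κ U T < cardUpTo κ U S := by
  refine Finset.card_lt_card ⟨Finset.monotone_filter_right _ fun _ _ hz => ⟨x, hxS, (hz x hxT).le⟩,
    fun hs => ?_⟩
  have hx := hs (Finset.mem_filter.2 ⟨hS hxS, x, hxS, le_rfl⟩)
  exact lt_irrefl _ ((Finset.mem_filter.1 hx).2 x hxT)

theorem disjoint_of_cardUpTo_le_cardBefore (hS : S ⊆ U) (h : cardUpTo κ U S ≤ cardBefore κ U T) :
    Disjoint S T :=
  Finset.disjoint_left.2 fun _ hxS hxT => h.not_gt (cardBefore_lt_cardUpTo hS hxS hxT)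

end Intervals

/-! ### Interval scheduling -/

/-- Jobs that occupy intervals `(lo i, hi i]`, to be packed without overlap. Packing job `i` adds
`weight i` to the total weight, and `credit i - debit i` to a balance that starts at `start`.
Balances are natural numbers, and `start` is so large that they stay positive. Only packings of
weight less than `cols` are of interest. -/
structure IntervalScheduling where
  /-- the available jobs -/
  jobs : Finset ℕ
  /-- left ends of the intervals -/
  lo : ℕ → ℕ
  /-- right ends of the intervals -/
  hi : ℕ → ℕ
  /-- weights -/
  weight : ℕ → ℕ
  /-- amounts added to the balance -/
  credit : ℕ → ℕ
  /-- amounts taken from the balance -/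
  debit : ℕ → ℕ
  /-- balance of the empty packing -/
  start : ℕ
  /-- strict bound for the weights of packings -/
  cols : ℕ
  lo_lt_hi : ∀ i ∈ jobs, lo i < hi i
  sum_debit_lt : ∑ i ∈ jobs, debit i < start

namespace IntervalScheduling

open Finset

variable (S : IntervalScheduling)

/-- The entries of the dynamic programming table in row-major order: entry number `t`, in terms of
the function `r` that gives the entries before. Zero stands for the absence of a packing. -/
def entry (t : ℕ) (r : ℕ → ℕ) : ℕ :=
  if t < S.cols then (if t = 0 then S.start else 0) else
    max (r (t - S.cols))
      ({i ∈ S.jobs | S.hi i = t / S.cols ∧ S.weight i ≤ t % S.cols ∧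
          r (S.lo i * S.cols + (t % S.cols - S.weight i)) ≠ 0}.sup fun i =>
        r (S.lo i * S.cols + (t % S.cols - S.weight i)) + S.credit i - S.debit i)

/-- The largest balance of a packing of weight `q` into the interval `(0, p]`. -/
def table (p q : ℕ) : ℕ := RAM.recTable S.entry (p * S.cols + q)

/-- A set of jobs with disjoint intervals contained in `(0, p]`. -/
structure Packing (p : ℕ) (A : Finset ℕ) : Prop where
  subset_jobs : A ⊆ S.jobs
  hi_le : ∀ i ∈ A, S.hi i ≤ p
  disjoint : (A : Set ℕ).Pairwise fun i j => S.hi i ≤ S.lo j ∨ S.hi j ≤ S.lo i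

variable {S} {p q : ℕ} {A : Finset ℕ}

theorem entry_le {t M : ℕ} {r : ℕ → ℕ} (hr : ∀ u, r u ≤ M) :
    S.entry t r ≤ M + (S.start + ∑ i ∈ S.jobs, S.credit i) := by
  unfold entry
  split_ifs
  · omega
  · exact Nat.zero_le _
  · refine max_le ((hr _).trans (Nat.le_add_right ..)) (Finset.sup_le fun i hi => ?_)
    have hcredit := single_le_sum (fun _ _ => Nat.zero_le _) (mem_filter.1 hi).1 (f := S.credit)
    have := hr (S.lo i * S.cols + (t % S.cols - S.weight i))
    omega

theorem table_zero (hq : q < S.cols) : S.table 0 q = if q = 0 then S.start else 0 := by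
  rw [table, RAM.recTable, entry]
  simp [hq]

theorem table_succ (hq : q < S.cols) :
    S.table (p + 1) q = max (S.table p q)
      ({i ∈ S.jobs | S.hi i = p + 1 ∧ S.weight i ≤ q ∧ S.table (S.lo i) (q - S.weight i) ≠ 0}.sup
        fun i => S.table (S.lo i) (q - S.weight i) + S.credit i - S.debit i) := by
  have hexp : (p + 1) * S.cols = p * S.cols + S.cols := by ring
  have hdiv : ((p + 1) * S.cols + q) / S.cols = p + 1 := by
    rw [add_comm, Nat.add_mul_div_right _ _ (by omega), Nat.div_eq_of_lt hq, zero_add]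
  have hmod : ((p + 1) * S.cols + q) % S.cols = q := by
    rw [add_comm, Nat.add_mul_mod_self_right, Nat.mod_eq_of_lt hq]
  have hprev : (p + 1) * S.cols + q - S.cols = p * S.cols + q := by omega
  have hearlier : ∀ i ∈ S.jobs, S.hi i = p + 1 →
      S.lo i * S.cols + (q - S.weight i) < (p + 1) * S.cols + q := by
    intro i hi hip
    have := Nat.mul_le_mul_right S.cols (show S.lo i ≤ p by have := S.lo_lt_hi i hi; omega)
    omega
  rw [table, RAM.recTable, entry, if_neg (by omega), hdiv, hmod, hprev, if_pos (by omega)]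
  refine congrArg₂ max rfl (sup_congr (filter_congr fun i hi => ?_) fun i hi => ?_)
  · refine and_congr_right fun hip => ?_
    rw [if_pos (hearlier i hi hip), table]
  · obtain ⟨hi, hip, -⟩ := mem_filter.1 hi
    rw [if_pos (hearlier i hi hip), table]

theorem table_succ_eq_or (hq : q < S.cols) (h : S.table (p + 1) q ≠ 0) :
    S.table (p + 1) q = S.table p q ∨
      ∃ i ∈ S.jobs, S.hi i = p + 1 ∧ S.weight i ≤ q ∧ S.table (S.lo i) (q - S.weight i) ≠ 0 ∧
        S.table (p + 1) q = S.table (S.lo i) (q - S.weight i) + S.credit i - S.debit i := by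
  rw [table_succ hq] at h ⊢
  refine (max_choice _ _).imp_right fun hmax => ?_
  rw [hmax] at h ⊢
  obtain ⟨i, hi, hsup⟩ := exists_mem_eq_sup {i ∈ S.jobs | S.hi i = p + 1 ∧ S.weight i ≤ q ∧
      S.table (S.lo i) (q - S.weight i) ≠ 0} (nonempty_of_ne_empty fun he => h (by
    rw [he, sup_empty, bot_eq_zero])) fun i =>
      S.table (S.lo i) (q - S.weight i) + S.credit i - S.debit i
  obtain ⟨hiS, hip, hiq, hne⟩ := mem_filter.1 hi
  exact ⟨i, hiS, hip, hiq, hne, hsup⟩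

theorem table_le_table_succ (hq : q < S.cols) : S.table p q ≤ S.table (p + 1) q :=
  (le_max_left _ _).trans_eq (table_succ hq).symm

theorem le_table_succ {i : ℕ} (hi : i ∈ S.jobs) (hip : S.hi i = p + 1)
    (hq : S.weight i + q < S.cols) (h : S.table (S.lo i) q ≠ 0) :
    S.table (S.lo i) q + S.credit i - S.debit i ≤ S.table (p + 1) (S.weight i + q) := by
  rw [table_succ hq]
  refine le_trans ?_ (le_max_right _ _)
  refine le_trans (le_of_eq ?_) (le_sup (b := i) (mem_filter.2 ⟨hi, hip, Nat.le_add_right .., ?_⟩))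
  · rw [Nat.add_sub_cancel_left]
  · rwa [Nat.add_sub_cancel_left]

theorem Packing.mono {p' : ℕ} (h : S.Packing p A) (hp : p ≤ p') : S.Packing p' A :=
  ⟨h.subset_jobs, fun i hi => (h.hi_le i hi).trans hp, h.disjoint⟩

theorem Packing.sum_debit_lt (h : S.Packing p A) : ∑ i ∈ A, S.debit i < S.start :=
  (sum_le_sum_of_subset h.subset_jobs).trans_lt S.sum_debit_lt

theorem Packing.notMem {i : ℕ} (hi : i ∈ S.jobs) (h : S.Packing (S.lo i) A) : i ∉ A :=
  fun hiA => (h.hi_le i hiA).not_gt (S.lo_lt_hi i hi)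

theorem Packing.insert {i : ℕ} (hi : i ∈ S.jobs) (h : S.Packing (S.lo i) A) :
    S.Packing (S.hi i) (insert i A) where
  subset_jobs := insert_subset hi h.subset_jobs
  hi_le := forall_mem_insert .. |>.2
    ⟨le_rfl, fun a ha => (h.hi_le a ha).trans (S.lo_lt_hi i hi).le⟩
  disjoint := by
    rw [coe_insert]
    exact h.disjoint.insert fun a ha _ => ⟨.inr (h.hi_le a ha), .inl (h.hi_le a ha)⟩

theorem Packing.erase {i : ℕ} (h : S.Packing (S.hi i) A) (hi : i ∈ A) :
    S.Packing (S.lo i) (A.erase i) where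
  subset_jobs := (erase_subset _ _).trans h.subset_jobs
  hi_le a ha := by
    have haA := mem_of_mem_erase ha
    rcases h.disjoint haA hi (ne_of_mem_erase ha) with hle | hle
    · exact hle
    · exact absurd ((h.hi_le a haA).trans hle) (S.lo_lt_hi a (h.subset_jobs haA)).not_ge
  disjoint := h.disjoint.mono (by simp)

theorem exists_packing (hq : q < S.cols) (h : S.table p q ≠ 0) :
    ∃ A, S.Packing p A ∧ ∑ i ∈ A, S.weight i = q ∧
      S.table p q + ∑ i ∈ A, S.debit i = S.start + ∑ i ∈ A, S.credit i := by
  induction p using Nat.strong_induction_on generalizing q with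
  | _ p ih =>
    cases p with
    | zero =>
      rw [table_zero hq] at h ⊢
      obtain rfl : q = 0 := by by_contra hq0; exact h (if_neg hq0)
      exact ⟨∅, ⟨by simp, by simp, by simp⟩, by simp, by simp⟩
    | succ p =>
      rcases table_succ_eq_or hq h with heq | ⟨i, hiS, hip, hiq, hne, heq⟩
      · rw [heq] at h ⊢
        obtain ⟨A, hA, hAq⟩ := ih p (by omega) hq h
        exact ⟨A, hA.mono (by omega), hAq⟩
      · rw [heq]
        have hlo := S.lo_lt_hi i hiS
        obtain ⟨A, hA, hAq, hAt⟩ := ih (S.lo i) (by omega) (q := q - S.weight i) (by omega) hne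
        have hiA := hA.notMem hiS
        have hlt := (hA.insert hiS).sum_debit_lt
        refine ⟨insert i A, hip ▸ hA.insert hiS, ?_, ?_⟩
        all_goals simp only [sum_insert hiA] at hlt ⊢; omega

theorem Packing.le_table (hA : S.Packing p A) (hq : ∑ i ∈ A, S.weight i < S.cols) :
    S.start + ∑ i ∈ A, S.credit i ≤ S.table p (∑ i ∈ A, S.weight i) + ∑ i ∈ A, S.debit i := by
  induction p using Nat.strong_induction_on generalizing A with
  | _ p ih =>
    cases p with
    | zero =>
      obtain rfl : A = ∅ := eq_empty_of_forall_notMem fun i hi =>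
        ((S.lo_lt_hi i (hA.subset_jobs hi)).trans_le (hA.hi_le i hi)).not_ge (Nat.zero_le _)
      rw [table_zero hq]
      simp
    | succ p =>
      by_cases hex : ∃ i ∈ A, S.hi i = p + 1
      · obtain ⟨i, hi, hip⟩ := hex
        have hiS := hA.subset_jobs hi
        have hlo := S.lo_lt_hi i hiS
        have hB : S.Packing (S.lo i) (A.erase i) := (hip ▸ hA).erase hi
        have hlt := hB.sum_debit_lt
        simp only [← add_sum_erase A _ hi] at hq ⊢
        have hprev := ih (S.lo i) (by omega) hB (by omega)
        have := le_table_succ hiS hip hq (by omega)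
        omega
      · push Not at hex
        have hB : S.Packing p A := ⟨hA.subset_jobs, fun i hi =>
          Nat.le_of_lt_succ ((hA.hi_le i hi).lt_of_ne (hex i hi)), hA.disjoint⟩
        exact (ih p (by omega) hB hq).trans (Nat.add_le_add_right (table_le_table_succ hq) _)

theorem Packing.exists_best (hA : S.Packing p A) (hq : ∑ i ∈ A, S.weight i < S.cols) :
    ∃ B, S.Packing p B ∧ ∑ i ∈ B, S.weight i = ∑ i ∈ A, S.weight i ∧
      S.table p (∑ i ∈ A, S.weight i) + ∑ i ∈ B, S.debit i = S.start + ∑ i ∈ B, S.credit i ∧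
      ∑ i ∈ A, S.credit i + ∑ i ∈ B, S.debit i ≤ ∑ i ∈ B, S.credit i + ∑ i ∈ A, S.debit i := by
  have hle := hA.le_table hq
  have hlt := hA.sum_debit_lt
  obtain ⟨B, hB, hBq, hBt⟩ := exists_packing (p := p) hq (by omega)
  exact ⟨B, hB, hBq, hBt, by omega⟩

end IntervalScheduling

/-! ### The algorithm for integral data -/

section Selection

open Finset

/-- An element of `T` that maximizes `f`, provided that all elements of `T` are less than `B`. -/
def argmaxBelow (B : ℕ) (T : Finset ℕ) (f : ℕ → ℕ) : ℕ := (T.sup fun w => f w * B + w) % B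

theorem argmaxBelow_mem_and_le {B : ℕ} {T : Finset ℕ} (hne : T.Nonempty) (hB : ∀ w ∈ T, w < B)
    (f : ℕ → ℕ) : argmaxBelow B T f ∈ T ∧ ∀ w ∈ T, f w ≤ f (argmaxBelow B T f) := by
  obtain ⟨v, hv, hsup⟩ := exists_mem_eq_sup T hne fun w => f w * B + w
  have heq : argmaxBelow B T f = v := by
    rw [argmaxBelow, hsup, add_comm, Nat.add_mul_mod_self_right, Nat.mod_eq_of_lt (hB v hv)]
  refine heq ▸ ⟨hv, fun w hw => Nat.le_of_lt_succ (Nat.lt_of_mul_lt_mul_right (a := B) ?_)⟩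
  have hle : f w * B + w ≤ f v * B + v := hsup ▸ le_sup (f := fun w => f w * B + w) hw
  have := hB v hv
  rw [Nat.succ_mul]
  omega

/-- What donor number `i` gives to a collection with target `c`, when the donors are asked in turn
for at most `f 0`, `f 1`, …, until the target is reached. -/
def collect (f : ℕ → ℕ) (c i : ℕ) : ℕ := min (f i) (c - ∑ a ∈ range i, f a)

theorem sum_collect (f : ℕ → ℕ) (c n : ℕ) :
    ∑ i ∈ range n, collect f c i = min c (∑ i ∈ range n, f i) := by
  induction n with
  | zero => simp
  | succ n ih =>
    rw [sum_range_succ, sum_range_succ, ih, collect]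
    omega

/-- Rounding down to multiples of `L / (n * k)` costs at most `L / k ≤ (∑ i ∈ A, gain i) / k` on a
set of at most `n` elements. -/
theorem mul_sum_le_of_sum_div_le {A B : Finset ℕ} {gain : ℕ → ℕ} {n k L : ℕ} (hL : 0 < L)
    (hA : #A ≤ n) (hLA : L ≤ ∑ i ∈ A, gain i)
    (h : ∑ i ∈ A, gain i * n * k / L ≤ ∑ i ∈ B, gain i * n * k / L) :
    k * ∑ i ∈ A, gain i ≤ k * ∑ i ∈ B, gain i + ∑ i ∈ A, gain i := by
  have hn : 0 < n := by
    refine (card_pos.2 (nonempty_of_ne_empty fun he => ?_)).trans_le hA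
    rw [he, sum_empty] at hLA
    omega
  have hup : ∑ i ∈ A, gain i * n * k ≤ L * ∑ i ∈ A, gain i * n * k / L + L * #A := by
    rw [mul_sum, mul_comm L #A, ← smul_eq_mul #A, ← sum_const, ← sum_add_distrib]
    exact sum_le_sum fun i _ => (Nat.lt_mul_div_succ _ hL).le.trans_eq (mul_add_one ..)
  have hdown : L * ∑ i ∈ B, gain i * n * k / L ≤ ∑ i ∈ B, gain i * n * k := by
    rw [mul_sum]
    exact sum_le_sum fun i _ => Nat.mul_div_le ..
  rw [← sum_mul, ← sum_mul] at hup hdown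
  refine Nat.le_of_mul_le_mul_left ?_ hn
  calc n * (k * ∑ i ∈ A, gain i) = (∑ i ∈ A, gain i) * n * k := by ring
    _ ≤ L * ∑ i ∈ A, gain i * n * k / L + L * #A := hup
    _ ≤ (∑ i ∈ B, gain i) * n * k + (∑ i ∈ A, gain i) * n :=
      Nat.add_le_add ((Nat.mul_le_mul_left L h).trans hdown) (Nat.mul_le_mul hLA hA)
    _ = n * (k * ∑ i ∈ B, gain i + ∑ i ∈ A, gain i) := by ring

end Selection

/-- Single-minded agents `0, …, n - 1` with integral data. Agents are characterized by their values
and by the largest payments that they accept for their demand sets. -/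
structure IntegralInstance where
  /-- number of agents -/
  n : ℕ
  /-- number of projects -/
  m : ℕ
  /-- demand sets -/
  D : ℕ → Finset ℕ
  /-- values of the demand sets -/
  Z : ℕ → ℕ
  /-- largest acceptable payments: the minima of budgets and values -/
  β : ℕ → ℕ
  /-- project costs -/
  C : ℕ → ℕ
  D_subset : ∀ i, D i ⊆ Finset.range m
  β_le : ∀ i, β i ≤ Z i

namespace IntegralInstance

open Finset

variable (P : IntegralInstance)

/-- Total cost of a bundle. -/
def cost (W : Finset ℕ) : ℕ := ∑ j ∈ W, P.C j

/-- The agents whose demand sets are contained in `W`. -/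
def satisfied (W : Finset ℕ) : Finset ℕ := {a ∈ range P.n | P.D a ⊆ W}

/-- Total value of a bundle. -/
def value (W : Finset ℕ) : ℕ := ∑ a ∈ P.satisfied W, P.Z a

/-- The largest total payment that the agents accept for a bundle. -/
def budget (W : Finset ℕ) : ℕ := ∑ a ∈ P.satisfied W, P.β a

/-- The agents are able and willing to pay for a bundle. -/
def Fundable (W : Finset ℕ) : Prop := P.cost W ≤ P.budget W

instance : DecidablePred P.Fundable := fun W => Nat.decLe (P.cost W) (P.budget W)

/-- Welfare of a bundle, with truncated subtraction. -/
def welfare (W : Finset ℕ) : ℕ := P.value W - P.cost W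

/-- The agents with nonempty demand sets contained in `W`. -/
def properlySatisfied (W : Finset ℕ) : Finset ℕ := containedIn (range P.n) P.D W

/-- The value gained by adding the demand set of agent `i` to a disjoint bundle. -/
def properValue (i : ℕ) : ℕ := ∑ a ∈ P.properlySatisfied (P.D i), P.Z a

/-- The budget gained by adding the demand set of agent `i` to a disjoint bundle. -/
def properBudget (i : ℕ) : ℕ := ∑ a ∈ P.properlySatisfied (P.D i), P.β a

/-- The welfare gained by adding the demand set of agent `i` to a disjoint bundle. -/
def gain (i : ℕ) : ℕ := P.properValue i - P.cost (P.D i)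

/-- The rank of an agent when the agents are sorted by the sizes of their demand sets. -/
def rank (i : ℕ) : ℕ := #(P.D i) * P.n + i

/-- A key for sorting the projects such that the demand sets of a laminar family become
intervals. -/
def key (j : ℕ) : ℕ := sortKey (range P.n) P.D P.rank j

variable {P}

theorem sum_satisfied (f : ℕ → ℕ) (W : Finset ℕ) :
    ∑ a ∈ P.satisfied W, f a = ∑ a ∈ P.satisfied ∅, f a + ∑ a ∈ P.properlySatisfied W, f a := by
  rw [← sum_filter_add_sum_filter_not (P.satisfied W) fun a => P.D a ⊆ ∅]
  congr 1 <;> refine sum_congr ?_ fun _ _ => rfl <;>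
    ext a <;> simp only [satisfied, properlySatisfied, containedIn, mem_filter, subset_empty,
      ← nonempty_iff_ne_empty]
  · grind
  · tauto

theorem rank_injOn : Set.InjOn P.rank (range P.n) := by
  intro i hi j hj hij
  simp only [coe_range, Set.mem_Iio, rank] at hi hj hij
  have hmod := congrArg (· % P.n) hij
  simpa only [add_comm, Nat.add_mul_mod_self_right, Nat.mod_eq_of_lt hi, Nat.mod_eq_of_lt hj]
    using hmod

theorem card_le_of_rank_le : ∀ i ∈ range P.n, ∀ j ∈ range P.n, P.rank i ≤ P.rank j →
    #(P.D i) ≤ #(P.D j) := by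
  intro i _ j hj hij
  rw [mem_range] at hj
  by_contra! hlt
  have := Nat.mul_le_mul_right P.n (Nat.succ_le_of_lt hlt)
  simp only [rank, Nat.succ_eq_add_one, add_mul] at hij this
  omega

theorem nonempty_of_cost_lt {i : ℕ} (h : P.cost (P.D i) < P.properValue i) : (P.D i).Nonempty := by
  obtain ⟨a, ha, -⟩ := exists_ne_zero_of_sum_ne_zero ((Nat.zero_le _).trans_lt h).ne'
  obtain ⟨-, hne, hsub⟩ := mem_filter.1 ha
  exact hne.mono hsub

variable (P)

/-- The demand sets as jobs, under the assumption that no demand set gains more welfare than that of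
agent `g`. The weights are the rounded gains; the balance is the surplus, shifted by `m` binary
digits in order to make room for the characteristic vector of the union of the demand sets. -/
def scheduling (k g : ℕ) : IntervalScheduling where
  jobs := {i ∈ range P.n | P.cost (P.D i) < P.properValue i ∧ P.gain i ≤ P.gain g}
  lo i := cardBefore P.key (range P.m) (P.D i)
  hi i := cardUpTo P.key (range P.m) (P.D i)
  weight i := P.gain i * P.n * k / P.gain g
  credit i := P.properBudget i * 2 ^ P.m + ∑ j ∈ P.D i, 2 ^ j
  debit i := P.cost (P.D i) * 2 ^ P.m
  start := (∑ i ∈ range P.n, P.cost (P.D i) + 1) * 2 ^ P.m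
  cols := P.n * P.n * k + 1
  lo_lt_hi i hi := by
    obtain ⟨x, hx⟩ := nonempty_of_cost_lt (mem_filter.1 hi).2.1
    exact cardBefore_lt_cardUpTo (P.D_subset i) hx hx
  sum_debit_lt := by
    rw [← sum_mul]
    exact Nat.mul_lt_mul_of_pos_right (Nat.lt_succ_of_le
      (sum_le_sum_of_subset (filter_subset _ _))) (by positivity)

/-- The set of projects with characteristic vector `w`. -/
def bundle (w : ℕ) : Finset ℕ := {j ∈ range P.m | w.testBit j}

/-- The characteristic vectors of the bundles found by the dynamic programs. -/
def candidates (k : ℕ) : Finset ℕ :=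
  insert 0 ((range P.n ×ˢ range (P.n * P.n * k + 1)).image fun x =>
    (P.scheduling k x.1).table P.m x.2 % 2 ^ P.m)

/-- The computed bundle: the best fundable candidate. -/
def funded (k : ℕ) : Finset ℕ :=
  P.bundle (argmaxBelow (2 ^ P.m) {w ∈ P.candidates k | P.Fundable (P.bundle w)} fun w =>
    P.welfare (P.bundle w))

/-- The computed payments. -/
def payment (k i : ℕ) : ℕ :=
  collect (fun a => if P.D a ⊆ P.funded k then P.β a else 0) (P.cost (P.funded k)) i

/-! ### The approximation guarantee -/

variable {P} {k g : ℕ} {A B W : Finset ℕ}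

theorem cost_biUnion (hA : (A : Set ℕ).PairwiseDisjoint P.D) :
    P.cost (A.biUnion P.D) = ∑ i ∈ A, P.cost (P.D i) :=
  sum_biUnion hA

theorem bundle_sum_two_pow (hW : W ⊆ range P.m) : P.bundle (∑ j ∈ W, 2 ^ j) = W := by
  ext j
  rw [bundle, mem_filter, testBit_sum_two_pow]
  exact ⟨And.right, fun hj => ⟨hW hj, hj⟩⟩

theorem bundle_zero : P.bundle 0 = ∅ := by simp [bundle]

theorem fundable_empty : P.Fundable ∅ := Nat.zero_le _

theorem lt_two_pow_of_mem_candidates {w : ℕ} (hw : w ∈ P.candidates k) : w < 2 ^ P.m := by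
  simp only [candidates, mem_insert, mem_image] at hw
  rcases hw with rfl | ⟨x, -, rfl⟩
  · positivity
  · exact Nat.mod_lt _ (by positivity)

theorem fundable_funded_and_le : P.Fundable (P.funded k) ∧
    ∀ w ∈ P.candidates k, P.Fundable (P.bundle w) →
      P.welfare (P.bundle w) ≤ P.welfare (P.funded k) := by
  have hne : {w ∈ P.candidates k | P.Fundable (P.bundle w)}.Nonempty :=
    ⟨0, mem_filter.2 ⟨mem_insert_self .., bundle_zero.symm ▸ fundable_empty⟩⟩
  obtain ⟨hmem, hle⟩ := argmaxBelow_mem_and_le hne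
    (fun w hw => lt_two_pow_of_mem_candidates (mem_filter.1 hw).1) fun w => P.welfare (P.bundle w)
  exact ⟨(mem_filter.1 hmem).2, fun w hw hfund => hle w (mem_filter.2 ⟨hw, hfund⟩)⟩

theorem pairwiseDisjoint_of_packing {p : ℕ} (hA : (P.scheduling k g).Packing p A) :
    (A : Set ℕ).PairwiseDisjoint P.D := fun i hi j hj hij =>
  (hA.disjoint hi hj hij).elim (disjoint_of_cardUpTo_le_cardBefore (P.D_subset i)) fun h =>
    (disjoint_of_cardUpTo_le_cardBefore (P.D_subset j) h).symm

theorem packing_of_pairwiseDisjoint (hP : LaminarOn (range P.n) P.D)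
    (hA : A ⊆ (P.scheduling k g).jobs) (hdisj : (A : Set ℕ).PairwiseDisjoint P.D) :
    (P.scheduling k g).Packing P.m A where
  subset_jobs := hA
  hi_le _ _ := cardUpTo_le_card.trans_eq (card_range _)
  disjoint _ hi _ hj hij :=
    (hP.sortKey_separates rank_injOn card_le_of_rank_le (mem_filter.1 (hA hi)).1
      (mem_filter.1 (hA hj)).1 (hdisj hi hj hij)).imp
      (cardUpTo_le_cardBefore (κ := P.key) (U := range P.m))
      (cardUpTo_le_cardBefore (κ := P.key) (U := range P.m))

theorem exists_profitable_family (hP : LaminarOn (range P.n) P.D) (hW : P.Fundable W) :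
    ∃ A ⊆ range P.n, (A : Set ℕ).PairwiseDisjoint P.D ∧
      (∀ i ∈ A, P.cost (P.D i) < P.properValue i) ∧
      P.welfare W ≤ P.value ∅ + ∑ i ∈ A, P.gain i ∧
      ∑ i ∈ A, P.cost (P.D i) ≤ P.budget ∅ + ∑ i ∈ A, P.properBudget i := by
  obtain ⟨M, hMW, hdisj, hsum⟩ := hP.exists_disjoint_sum_containedIn W
  have hvalue : P.value W ≤ P.value ∅ + ∑ i ∈ M, P.properValue i :=
    (sum_satisfied P.Z W).trans_le (Nat.add_le_add_left (hsum P.Z) _)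
  have hbudget : P.budget W ≤ P.budget ∅ + ∑ i ∈ M, P.properBudget i :=
    (sum_satisfied P.β W).trans_le (Nat.add_le_add_left (hsum P.β) _)
  have hcost : ∑ i ∈ M, P.cost (P.D i) ≤ P.cost W := by
    rw [← cost_biUnion hdisj]
    exact sum_le_sum_of_subset (biUnion_subset.2 fun i hi => (mem_filter.1 (hMW hi)).2.2)
  have hgain : ∑ i ∈ M with P.cost (P.D i) < P.properValue i, P.properValue i ≤
      ∑ i ∈ M with P.cost (P.D i) < P.properValue i, P.gain i +
        ∑ i ∈ M with P.cost (P.D i) < P.properValue i, P.cost (P.D i) := by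
    rw [← sum_add_distrib]
    exact sum_le_sum fun i _ => le_tsub_add
  have hrest : ∑ i ∈ M with ¬P.cost (P.D i) < P.properValue i, P.properValue i ≤
      ∑ i ∈ M with ¬P.cost (P.D i) < P.properValue i, P.cost (P.D i) :=
    sum_le_sum fun i hi => not_lt.1 (mem_filter.1 hi).2
  have hrest' : ∑ i ∈ M with ¬P.cost (P.D i) < P.properValue i, P.properBudget i ≤
      ∑ i ∈ M with ¬P.cost (P.D i) < P.properValue i, P.properValue i :=
    sum_le_sum fun i _ => sum_le_sum fun a _ => P.β_le a
  have hfund : P.cost W ≤ P.budget W := hW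
  simp only [← sum_filter_add_sum_filter_not M fun i => P.cost (P.D i) < P.properValue i]
    at hvalue hbudget hcost
  refine ⟨{i ∈ M | P.cost (P.D i) < P.properValue i},
    (filter_subset _ _).trans (hMW.trans (filter_subset _ _)),
    hdisj.subset (coe_subset.2 (filter_subset _ _)), fun i hi => (mem_filter.1 hi).2, ?_, ?_⟩
  · rw [welfare]
    omega
  · omega

theorem fundable_biUnion_and_le_welfare (hB : (B : Set ℕ).PairwiseDisjoint P.D)
    (hprofit : ∀ i ∈ B, P.cost (P.D i) < P.properValue i)
    (hsurplus : ∑ i ∈ B, P.cost (P.D i) ≤ P.budget ∅ + ∑ i ∈ B, P.properBudget i) :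
    P.Fundable (B.biUnion P.D) ∧
      P.value ∅ + ∑ i ∈ B, P.gain i ≤ P.welfare (B.biUnion P.D) := by
  have hvalue : P.value ∅ + ∑ i ∈ B, P.properValue i ≤ P.value (B.biUnion P.D) :=
    (Nat.add_le_add_left (sum_containedIn_le_sum_biUnion hB P.Z) _).trans_eq
      (sum_satisfied P.Z _).symm
  have hbudget : P.budget ∅ + ∑ i ∈ B, P.properBudget i ≤ P.budget (B.biUnion P.D) :=
    (Nat.add_le_add_left (sum_containedIn_le_sum_biUnion hB P.β) _).trans_eq
      (sum_satisfied P.β _).symm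
  have hgain : ∑ i ∈ B, P.gain i + ∑ i ∈ B, P.cost (P.D i) = ∑ i ∈ B, P.properValue i := by
    rw [← sum_add_distrib]
    exact sum_congr rfl fun i hi => Nat.sub_add_cancel (hprofit i hi).le
  rw [Fundable, welfare, cost_biUnion hB]
  exact ⟨hsurplus.trans hbudget, by omega⟩

theorem exists_packing_eq_bundle_table (hA : (P.scheduling k g).Packing P.m A)
    (hq : ∑ i ∈ A, (P.scheduling k g).weight i < (P.scheduling k g).cols) :
    ∃ B, (P.scheduling k g).Packing P.m B ∧
      ∑ i ∈ B, (P.scheduling k g).weight i = ∑ i ∈ A, (P.scheduling k g).weight i ∧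
      P.bundle ((P.scheduling k g).table P.m (∑ i ∈ A, (P.scheduling k g).weight i) % 2 ^ P.m) =
        B.biUnion P.D ∧
      ∑ i ∈ A, P.properBudget i + ∑ i ∈ B, P.cost (P.D i) ≤
        ∑ i ∈ B, P.properBudget i + ∑ i ∈ A, P.cost (P.D i) := by
  obtain ⟨B, hB, hBq, htable, hle⟩ := hA.exists_best hq
  have hsub : ∀ A : Finset ℕ, A.biUnion P.D ⊆ range P.m :=
    fun A => biUnion_subset.2 fun i _ => P.D_subset i
  have hcode : ∀ {A}, (P.scheduling k g).Packing P.m A →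
      ∑ i ∈ A, ∑ j ∈ P.D i, 2 ^ j = ∑ j ∈ A.biUnion P.D, 2 ^ j :=
    fun hA => (sum_biUnion (pairwiseDisjoint_of_packing hA)).symm
  have hcode_lt : ∀ A : Finset ℕ, ∑ j ∈ A.biUnion P.D, 2 ^ j < 2 ^ P.m :=
    fun A => Nat.geomSum_lt le_rfl fun j hj => mem_range.1 (hsub A hj)
  have hcredit : ∀ {A}, (P.scheduling k g).Packing P.m A →
      ∑ i ∈ A, (P.scheduling k g).credit i =
        (∑ i ∈ A, P.properBudget i) * 2 ^ P.m + ∑ j ∈ A.biUnion P.D, 2 ^ j := fun {A} hA => by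
    simp only [scheduling, sum_add_distrib, ← sum_mul, hcode hA]
  have hdebit : ∀ A, ∑ i ∈ A, (P.scheduling k g).debit i =
      (∑ i ∈ A, P.cost (P.D i)) * 2 ^ P.m := fun A => (sum_mul ..).symm
  have hstart : (P.scheduling k g).start = (∑ i ∈ range P.n, P.cost (P.D i) + 1) * 2 ^ P.m := rfl
  rw [hcredit hB, hdebit, hstart] at htable
  rw [hcredit hA, hcredit hB, hdebit, hdebit] at hle
  refine ⟨B, hB, hBq, ?_, ?_⟩
  · rw [← bundle_sum_two_pow (hsub B)]
    congr 1
    have hmod := congrArg (· % 2 ^ P.m) htable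
    simpa only [Nat.add_mul_mod_self_right, ← add_assoc, ← add_mul, Nat.mul_add_mod_self_right,
      Nat.mod_eq_of_lt (hcode_lt B)] using hmod
  · refine Nat.le_of_lt_succ (Nat.lt_of_mul_lt_mul_right (a := 2 ^ P.m) ?_)
    have := hcode_lt B
    simp only [Nat.succ_eq_add_one, add_mul, one_mul] at hle ⊢
    omega

theorem sum_weight_lt_cols (hA : A ⊆ (P.scheduling k g).jobs) :
    ∑ i ∈ A, (P.scheduling k g).weight i < (P.scheduling k g).cols := by
  have hcard : #A ≤ P.n := by
    simpa only [card_range] using card_le_card (hA.trans (filter_subset _ _))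
  refine Nat.lt_succ_of_le (le_trans (sum_le_card_nsmul A _ (P.n * k) fun i hi => ?_) ?_)
  · refine Nat.div_le_of_le_mul ?_
    rw [mul_assoc]
    exact Nat.mul_le_mul_right _ (mem_filter.1 (hA hi)).2.2
  · rw [smul_eq_mul, mul_assoc]
    exact Nat.mul_le_mul_right _ hcard

theorem exists_gain_le_welfare_funded (hP : LaminarOn (range P.n) P.D) (hA : A ⊆ range P.n)
    (hdisj : (A : Set ℕ).PairwiseDisjoint P.D)
    (hprofit : ∀ i ∈ A, P.cost (P.D i) < P.properValue i)
    (hsurplus : ∑ i ∈ A, P.cost (P.D i) ≤ P.budget ∅ + ∑ i ∈ A, P.properBudget i) :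
    ∃ G, P.value ∅ + G ≤ P.welfare (P.funded k) ∧
      k * ∑ i ∈ A, P.gain i ≤ k * G + ∑ i ∈ A, P.gain i := by
  rcases A.eq_empty_or_nonempty with rfl | hne
  · refine ⟨0, le_trans (le_of_eq ?_) (fundable_funded_and_le.2 0 (mem_insert_self ..) ?_), by simp⟩
    · simp [bundle_zero, welfare, cost]
    · exact bundle_zero.symm ▸ fundable_empty
  obtain ⟨g, hg, hmax⟩ := exists_max_image A P.gain hne
  have hjobs : A ⊆ (P.scheduling k g).jobs :=
    fun i hi => mem_filter.2 ⟨hA hi, hprofit i hi, hmax i hi⟩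
  have hq := sum_weight_lt_cols hjobs
  obtain ⟨B, hB, hweight, hbundle, hle⟩ :=
    exists_packing_eq_bundle_table (packing_of_pairwiseDisjoint hP hjobs hdisj) hq
  obtain ⟨hfund, hwelfare⟩ := fundable_biUnion_and_le_welfare (pairwiseDisjoint_of_packing hB)
    (fun i hi => (mem_filter.1 (hB.subset_jobs hi)).2.1) (by omega)
  refine ⟨∑ i ∈ B, P.gain i, hwelfare.trans ?_, mul_sum_le_of_sum_div_le (n := P.n)
    (Nat.sub_pos_of_lt (hprofit g hg)) ?_
    (single_le_sum (f := P.gain) (fun _ _ => Nat.zero_le _) hg) hweight.ge⟩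
  · rw [← hbundle] at hfund ⊢
    refine fundable_funded_and_le.2 _ (mem_insert_of_mem (mem_image.2 ⟨(g, _), ?_, rfl⟩)) hfund
    exact mem_product.2 ⟨hA hg, mem_range.2 hq⟩
  · simpa only [card_range] using card_le_card hA

theorem mul_welfare_le (hP : LaminarOn (range P.n) P.D) (hW : P.Fundable W) :
    k * P.welfare W ≤ k * P.welfare (P.funded k) + P.welfare W := by
  obtain ⟨A, hA, hdisj, hprofit, hwelfare, hsurplus⟩ := exists_profitable_family hP hW
  obtain ⟨G, hG, hGA⟩ := exists_gain_le_welfare_funded (k := k) hP hA hdisj hprofit hsurplus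
  rcases k with _ | k
  · simp
  have := Nat.mul_le_mul_left k hwelfare
  have := Nat.mul_le_mul_left (k + 1) hG
  linarith

theorem payment_le (k i : ℕ) :
    P.payment k i ≤ if P.D i ⊆ P.funded k then P.β i else 0 :=
  min_le_left ..

theorem sum_payment (k : ℕ) : ∑ i ∈ range P.n, P.payment k i = P.cost (P.funded k) := by
  have hfund : P.cost (P.funded k) ≤ P.budget (P.funded k) := fundable_funded_and_le.1
  rw [budget, satisfied, sum_filter] at hfund
  exact (sum_collect ..).trans (min_eq_left hfund)

end IntegralInstance

/-! ### Outcomes and bundles -/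

namespace PBInstance

open Finset

variable {n m : ℕ} (I : PBInstance n m)

/-- The agents can pay for a bundle without exceeding their budgets or their values. -/
def Fundable (S : Finset (Fin m)) : Prop := I.cost S ≤ ∑ i, min (I.v i S) (I.b i)

/-- Social welfare of a bundle that is funded exactly. -/
def welfare (S : Finset (Fin m)) : ℝ := ∑ i, I.v i S - I.cost S

variable {I} {o : PBOutcome n m}

theorem Feasible.fundable (ho : I.Feasible o) (hWP : I.WP o) : I.Fundable o.W :=
  ho.2.trans (sum_le_sum fun i _ => le_min (sub_nonneg.1 (hWP i)) (ho.1 i))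

theorem Feasible.SW_le_welfare (ho : I.Feasible o) : I.SW o ≤ I.welfare o.W :=
  (sum_sub_distrib ..).trans_le (sub_le_sub_left ho.2 _)

theorem feasible_wp_SW_eq_welfare (hx : ∀ i, o.x i ≤ min (I.v i o.W) (I.b i))
    (hsum : ∑ i, o.x i = I.cost o.W) : I.Feasible o ∧ I.WP o ∧ I.SW o = I.welfare o.W :=
  ⟨⟨fun i => (hx i).trans (min_le_right ..), hsum.ge⟩,
    fun i => sub_nonneg.2 ((hx i).trans (min_le_left ..)),
    (sum_sub_distrib ..).trans (congrArg _ hsum)⟩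

theorem Fundable.exists_payments {S : Finset (Fin m)} (hS : I.Fundable S) :
    ∃ x, I.Feasible ⟨S, x⟩ ∧ I.WP ⟨S, x⟩ ∧ I.SW ⟨S, x⟩ = I.welfare S := by
  have hmin : ∀ i, 0 ≤ min (I.v i S) (I.b i) := fun i => le_min (I.v_nonneg i S) (I.b_nonneg i)
  have hcost : 0 ≤ I.cost S := sum_nonneg fun j _ => I.C_nonneg j
  have htotal : 0 ≤ ∑ i, min (I.v i S) (I.b i) := sum_nonneg fun i _ => hmin i
  refine ⟨fun i => min (I.v i S) (I.b i) * (I.cost S / ∑ i, min (I.v i S) (I.b i)),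
    feasible_wp_SW_eq_welfare
      (fun i => mul_le_of_le_one_right (hmin i) (div_le_one_of_le₀ hS htotal)) ?_⟩
  rw [← sum_mul]
  exact mul_div_cancel_of_imp' fun h => le_antisymm (hS.trans_eq h) hcost

theorem exists_isUWOWP (I : PBInstance n m) :
    ∃ opt, I.IsUWOWP opt ∧ I.SW opt = I.welfare opt.W := by
  classical
  have hempty : I.Fundable ∅ :=
    sum_empty.trans_le (sum_nonneg fun i _ => le_min (I.v_nonneg i ∅) (I.b_nonneg i))
  obtain ⟨S, hS, hmax⟩ := exists_max_image {S : Finset (Fin m) | I.Fundable S} I.welfare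
    ⟨∅, mem_filter.2 ⟨mem_univ _, hempty⟩⟩
  obtain ⟨x, hx, hWP, hSW⟩ := (mem_filter.1 hS).2.exists_payments
  refine ⟨⟨S, x⟩, ⟨hx, hWP, fun o ho hoWP => ho.SW_le_welfare.trans ?_⟩, hSW⟩
  exact (hmax _ (mem_filter.2 ⟨mem_univ _, ho.fundable hoWP⟩)).trans_eq hSW.symm

end PBInstance

/-! ### Clearing denominators -/

namespace SingleMinded

open Finset RAM

variable (I : SingleMinded)

/-- A common denominator of all values, budgets and costs. -/
def commonDen : ℕ := (∏ i, (I.z i).den * (I.b i).den) * ∏ j, (I.C j).den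

/-- A number multiplied by the common denominator, which its denominator is assumed to divide. -/
def scale (x : ℚ≥0) : ℕ := x.num * (I.commonDen / x.den)

/-- The instance multiplied by the common denominator, with numbers for the elements of `Fin`. -/
def toIntegral : IntegralInstance where
  n := I.n
  m := I.m
  D i := if h : i < I.n then (I.D ⟨i, h⟩).map Fin.valEmbedding else ∅
  Z := ofFin fun i => I.scale (I.z i)
  β := ofFin fun i => min (I.scale (I.z i)) (I.scale (I.b i))
  C := ofFin fun j => I.scale (I.C j)
  D_subset i := by
    split_ifs with h
    · exact fun x hx => by
        obtain ⟨j, -, rfl⟩ := mem_map.1 hx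
        exact mem_range.2 j.2
    · exact empty_subset _
  β_le i := by
    unfold ofFin
    split_ifs
    · exact min_le_left ..
    · exact le_rfl

/-- The computed outcome: the integral payments divided by the common denominator. -/
noncomputable def outcome (k : ℕ) : PBOutcome I.n I.m where
  W := {j | (j : ℕ) ∈ I.toIntegral.funded k}
  x i := (I.toIntegral.payment k i : ℝ) / (I.commonDen : ℝ)

variable {I}

theorem commonDen_pos : 0 < I.commonDen :=
  Nat.mul_pos (prod_pos fun _ _ => Nat.mul_pos (NNRat.den_pos _) (NNRat.den_pos _))
    (prod_pos fun _ _ => NNRat.den_pos _)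

theorem den_z_mul_den_b_dvd (i : Fin I.n) : (I.z i).den * (I.b i).den ∣ I.commonDen :=
  (dvd_prod_of_mem (fun i => (I.z i).den * (I.b i).den) (mem_univ i)).mul_right _

theorem den_C_dvd (j : Fin I.m) : (I.C j).den ∣ I.commonDen :=
  (dvd_prod_of_mem (fun j => (I.C j).den) (mem_univ j)).mul_left _

theorem cast_scale {x : ℚ≥0} (hx : x.den ∣ I.commonDen) : (I.scale x : ℝ) = x * I.commonDen := by
  have hx' : (x.den : ℝ) ≠ 0 := Nat.cast_ne_zero.2 (NNRat.den_pos x).ne'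
  rw [scale, Nat.cast_mul, Nat.cast_div hx hx', NNRat.cast_def x, mul_div_assoc',
    div_mul_eq_mul_div]

theorem toIntegral_D (i : Fin I.n) : I.toIntegral.D i = (I.D i).map Fin.valEmbedding := dif_pos i.2

theorem toIntegral_Z (i : Fin I.n) : I.toIntegral.Z i = I.scale (I.z i) := dif_pos i.2

theorem toIntegral_β (i : Fin I.n) :
    I.toIntegral.β i = min (I.scale (I.z i)) (I.scale (I.b i)) := dif_pos i.2

theorem toIntegral_C (j : Fin I.m) : I.toIntegral.C j = I.scale (I.C j) := dif_pos j.2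

theorem cast_Z (i : Fin I.n) : (I.toIntegral.Z i : ℝ) = I.z i * I.commonDen := by
  rw [toIntegral_Z, cast_scale ((dvd_mul_right ..).trans (den_z_mul_den_b_dvd i))]

theorem cast_β (i : Fin I.n) :
    (I.toIntegral.β i : ℝ) = min (I.z i : ℝ) (I.b i) * I.commonDen := by
  rw [toIntegral_β, Nat.cast_min, cast_scale ((dvd_mul_right ..).trans (den_z_mul_den_b_dvd i)),
    cast_scale ((dvd_mul_left ..).trans (den_z_mul_den_b_dvd i)),
    min_mul_of_nonneg _ _ (Nat.cast_nonneg _)]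

theorem Laminar.laminarOn (hI : I.Laminar) : LaminarOn (range I.n) I.toIntegral.D := by
  intro i hi j hj
  lift i to Fin I.n using mem_range.1 hi
  lift j to Fin I.n using mem_range.1 hj
  rw [toIntegral_D, toIntegral_D, disjoint_map, map_subset_map, map_subset_map,
    disjoint_iff_inter_eq_empty, ← inter_eq_left, ← inter_eq_right]
  exact hI i j

theorem sum_satisfied_map (f : ℕ → ℕ) (W : Finset (Fin I.m)) :
    ∑ a ∈ I.toIntegral.satisfied (W.map Fin.valEmbedding), f a =
      ∑ i : Fin I.n, if I.D i ⊆ W then f i else 0 := by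
  rw [IntegralInstance.satisfied, sum_filter]
  exact (sum_range (n := I.n) _).trans
    (sum_congr rfl fun i _ => by simp only [toIntegral_D, map_subset_map])

theorem cast_cost (W : Finset (Fin I.m)) :
    (I.toIntegral.cost (W.map Fin.valEmbedding) : ℝ) = I.toInstance.cost W * I.commonDen := by
  rw [IntegralInstance.cost, sum_map, PBInstance.cost, sum_mul, Nat.cast_sum]
  refine sum_congr rfl fun j _ => ?_
  exact (congrArg Nat.cast (toIntegral_C j)).trans (cast_scale (den_C_dvd j))

theorem cast_value (W : Finset (Fin I.m)) :
    (I.toIntegral.value (W.map Fin.valEmbedding) : ℝ) =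
      (∑ i, I.toInstance.v i W) * I.commonDen := by
  rw [IntegralInstance.value, sum_satisfied_map, sum_mul, Nat.cast_sum]
  refine sum_congr rfl fun i _ => ?_
  rw [toInstance, ite_mul, zero_mul, Nat.cast_ite, Nat.cast_zero, cast_Z]

theorem min_v_b (i : Fin I.n) (W : Finset (Fin I.m)) :
    min (I.toInstance.v i W) (I.toInstance.b i) =
      if I.D i ⊆ W then min (I.z i : ℝ) (I.b i) else 0 := by
  simp only [toInstance]
  split_ifs
  · rfl
  · exact min_eq_left (NNRat.cast_nonneg _)

theorem cast_budget (W : Finset (Fin I.m)) :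
    (I.toIntegral.budget (W.map Fin.valEmbedding) : ℝ) =
      (∑ i, min (I.toInstance.v i W) (I.toInstance.b i)) * I.commonDen := by
  rw [IntegralInstance.budget, sum_satisfied_map, sum_mul, Nat.cast_sum]
  refine sum_congr rfl fun i _ => ?_
  rw [min_v_b, ite_mul, zero_mul, Nat.cast_ite, Nat.cast_zero, cast_β]

theorem fundable_map_iff {W : Finset (Fin I.m)} :
    I.toIntegral.Fundable (W.map Fin.valEmbedding) ↔ I.toInstance.Fundable W := by
  rw [IntegralInstance.Fundable, ← Nat.cast_le (α := ℝ), cast_cost, cast_budget,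
    mul_le_mul_iff_left₀ (Nat.cast_pos.2 commonDen_pos), PBInstance.Fundable]

theorem cast_welfare {W : Finset (Fin I.m)} (hW : I.toInstance.Fundable W) :
    (I.toIntegral.welfare (W.map Fin.valEmbedding) : ℝ) =
      I.toInstance.welfare W * I.commonDen := by
  have hle : I.toIntegral.cost (W.map Fin.valEmbedding) ≤
      I.toIntegral.value (W.map Fin.valEmbedding) :=
    (fundable_map_iff.2 hW).trans (sum_le_sum fun a _ => I.toIntegral.β_le a)
  rw [IntegralInstance.welfare, Nat.cast_sub hle, cast_value, cast_cost, ← sub_mul,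
    PBInstance.welfare]

variable {k : ℕ}

theorem map_outcome_W : (I.outcome k).W.map Fin.valEmbedding = I.toIntegral.funded k := by
  ext x
  rw [mem_map]
  constructor
  · rintro ⟨j, hj, rfl⟩
    exact (mem_filter.1 hj).2
  · exact fun hx => ⟨⟨x, mem_range.1 (mem_filter.1 hx).1⟩, mem_filter.2 ⟨mem_univ _, hx⟩, rfl⟩

theorem fundable_outcome_W : I.toInstance.Fundable (I.outcome k).W := by
  rw [← fundable_map_iff, map_outcome_W]
  exact IntegralInstance.fundable_funded_and_le.1

theorem feasible_wp_SW_outcome : I.toInstance.Feasible (I.outcome k) ∧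
    I.toInstance.WP (I.outcome k) ∧
    I.toInstance.SW (I.outcome k) = I.toInstance.welfare (I.outcome k).W := by
  have hpos : (0 : ℝ) < I.commonDen := Nat.cast_pos.2 commonDen_pos
  refine PBInstance.feasible_wp_SW_eq_welfare (fun i => (div_le_iff₀ hpos).2 ?_) ?_
  · rw [min_v_b, ite_mul, zero_mul, ← cast_β, ← Nat.cast_zero, ← Nat.cast_ite, Nat.cast_le]
    have hle := IntegralInstance.payment_le (P := I.toIntegral) k i
    simpa only [toIntegral_D, ← map_outcome_W, map_subset_map] using hle
  · have hsum := congrArg (Nat.cast (R := ℝ)) (IntegralInstance.sum_payment (P := I.toIntegral) k)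
    rw [← map_outcome_W, cast_cost, Nat.cast_sum] at hsum
    rw [outcome, ← sum_div, div_eq_iff hpos.ne', ← outcome, ← hsum]
    exact (sum_range (n := I.n) fun i => ((I.toIntegral.payment k i : ℕ) : ℝ)).symm

theorem exists_isUWOWP_le_SW_outcome (hI : I.Laminar) {ε : ℝ} (hε : 0 < ε) (hk : 1 / ε ≤ k) :
    ∃ opt, I.toInstance.IsUWOWP opt ∧
      (1 - ε) * I.toInstance.SW opt ≤ I.toInstance.SW (I.outcome k) := by
  obtain ⟨opt, hopt, hSW⟩ := I.toInstance.exists_isUWOWP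
  have hfund := hopt.1.fundable hopt.2.1
  have happrox := (Nat.cast_le (α := ℝ)).2
    (IntegralInstance.mul_welfare_le (k := k) hI.laminarOn (fundable_map_iff.2 hfund))
  rw [← map_outcome_W] at happrox
  push_cast [cast_welfare hfund, cast_welfare fundable_outcome_W, ← hSW,
    ← feasible_wp_SW_outcome.2.2] at happrox
  refine ⟨opt, hopt, ?_⟩
  have hpos : (0 : ℝ) < I.commonDen := Nat.cast_pos.2 commonDen_pos
  have hnonneg : 0 ≤ I.toInstance.SW opt := sum_nonneg fun i _ => hopt.2.1 i
  have hkε : 1 ≤ (k : ℝ) * ε := (div_le_iff₀ hε).1 hk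
  have hk0 : (0 : ℝ) < k := (one_div_pos.2 hε).trans_le hk
  refine le_of_mul_le_mul_left ?_ (mul_pos hk0 hpos)
  linarith [mul_nonneg (sub_nonneg.2 hkε) (mul_nonneg hnonneg hpos.le)]

end SingleMinded

/-! ### The algorithm runs in polynomial time -/

namespace RAM

open Ctx Finset IntegralInstance

theorem mem_toIntegral_D_iff {I : SingleMinded} {k i j : ℕ} : j ∈ I.toIntegral.D i ↔
    i < I.n ∧ j < I.m ∧ (I.input k).arr 6 (i * I.m + j) = 1 := by
  constructor
  · intro h
    have hi : i < I.n := by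
      by_contra hi
      exact notMem_empty j ((dif_neg hi : I.toIntegral.D i = ∅) ▸ h)
    lift i to Fin I.n using hi
    rw [SingleMinded.toIntegral_D] at h
    obtain ⟨x, hx, rfl⟩ := mem_map.1 h
    exact ⟨i.2, x.2, if_pos ⟨i, x, rfl, hx⟩⟩
  · rintro ⟨hi, hj, h⟩
    lift i to Fin I.n using hi
    obtain ⟨i', j', heq, hmem⟩ := of_not_not fun hn => zero_ne_one ((if_neg hn).symm.trans h)
    have hmod := congrArg (· % I.m) heq
    have hdiv := congrArg (· / I.m) heq
    simp only [mul_comm _ I.m, Nat.mul_add_mod, Nat.mod_eq_of_lt hj, Nat.mod_eq_of_lt j'.2] at hmod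
    simp only [mul_comm _ I.m, Nat.mul_add_div (Nat.zero_lt_of_lt hj), Nat.div_eq_of_lt hj,
      Nat.div_eq_of_lt j'.2, add_zero] at hdiv
    rw [SingleMinded.toIntegral_D, Fin.ext hdiv, hmod]
    exact mem_map_of_mem Fin.valEmbedding hmem

variable {α γ : Type} [Ctx α] [LocalVar γ]

/-- The integral instance obtained from the query of a context. -/
abbrev scaled (a : α) : IntegralInstance := (query a).inst.toIntegral

/-- The scheduling problem obtained from the query of a context and from agent `g`. -/
abbrev scheduled (a : α) (g : ℕ) : IntervalScheduling := (scaled a).scheduling (query a).acc g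

/-- Sets of projects whose characteristic vectors are computed in polynomial time. -/
def PolySet (W : α → Finset ℕ) : Prop :=
  ∃ w : α → ℕ, PolyTime w ∧ ∀ a, W a = (scaled a).bundle (w a)

variable {i j g t q w B X : α → ℕ} {V W : α → Finset ℕ}

namespace PolyTime

theorem commonDen : PolyTime (fun a : α => (query a).inst.commonDen) := by
  have hzb : PolyTime fun a : α => ∏ i ∈ range (query a).inst.n,
      (query a).input.arr 1 i * (query a).input.arr 3 i :=
    prod (f := fun a i => (query a).input.arr 1 i * (query a).input.arr 3 i) .agents
      ((inputArr (by omega) snd).mul (inputArr (by omega) snd))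
  have hC : PolyTime fun a : α => ∏ j ∈ range (query a).inst.m, (query a).input.arr 5 j :=
    prod (f := fun a j => (query a).input.arr 5 j) .projects (inputArr (by omega) snd)
  refine (hzb.mul hC).congr fun a => ?_
  rw [prod_range, prod_range]
  simp [Query.input, SingleMinded.input, SingleMinded.commonDen, ofFin]

theorem Z (hi : PolyTime i) : PolyTime (fun a => (scaled a).Z (i a)) :=
  ((inputArr (c := 0) (by omega) hi).mul
    (commonDen.div (inputArr (c := 1) (by omega) hi))).congr fun a => by
      simp only [Query.input, SingleMinded.input, SingleMinded.toIntegral, SingleMinded.scale,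
        ofFin]
      split_ifs <;> simp

theorem β (hi : PolyTime i) : PolyTime (fun a => (scaled a).β (i a)) :=
  ((Z hi).min ((inputArr (c := 2) (by omega) hi).mul
    (commonDen.div (inputArr (c := 3) (by omega) hi)))).congr fun a => by
      simp only [Query.input, SingleMinded.input, SingleMinded.toIntegral, SingleMinded.scale,
        ofFin]
      split_ifs <;> simp

theorem C (hj : PolyTime j) : PolyTime (fun a => (scaled a).C (j a)) :=
  ((inputArr (c := 4) (by omega) hj).mul
    (commonDen.div (inputArr (c := 5) (by omega) hj))).congr fun a => by
      simp only [Query.input, SingleMinded.input, SingleMinded.toIntegral, SingleMinded.scale,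
        ofFin]
      split_ifs <;> simp

end PolyTime

theorem PolyTime.two_pow (hi : Unary i) : PolyTime (fun a => 2 ^ i a) := .pow (.const 2) hi

theorem PolyDec.mem_D (hi : PolyTime i) (hj : PolyTime j) :
    PolyDec (fun a => j a ∈ (scaled a).D (i a)) :=
  ((lt hi Unary.agents.1).and ((lt hj Unary.projects.1).and (eq (.inputArr (c := 6) (by omega)
    ((hi.mul Unary.projects.1).add hj)) (.const 1)))).congr fun _ => mem_toIntegral_D_iff.symm

namespace PolySet

theorem bundle (hw : PolyTime w) : PolySet (fun a => (scaled a).bundle (w a)) :=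
  ⟨w, hw, fun _ => rfl⟩

theorem fst (hW : PolySet W) : PolySet (fun a : α × γ => W a.1) :=
  let ⟨w, hw, h⟩ := hW
  ⟨fun a => w a.1, hw.fst, fun a => h a.1⟩

theorem subset_range (hW : PolySet W) (a : α) : W a ⊆ range (scaled a).m :=
  let ⟨_, _, h⟩ := hW
  (h a).trans_subset (filter_subset _ _)

theorem mem (hW : PolySet W) (hj : Unary j) : PolyDec (fun a => j a ∈ W a) :=
  let ⟨_, hw, h⟩ := hW
  ((PolyDec.lt hj.1 Unary.projects.1).and (.testBit hw hj)).congr fun a => by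
    rw [h, IntegralInstance.bundle, mem_filter, mem_range]
    rfl

theorem D (hi : PolyTime i) : PolySet (fun a => (scaled a).D (i a)) := by
  refine ⟨_, .sumFilter (P := fun a j => j ∈ (scaled a).D (i a)) (f := fun _ j => 2 ^ j) .projects
    (.mem_D (α := α × ℕ) hi.fst .snd) (.two_pow .snd), fun a => ?_⟩
  have hsub : (scaled a).D (i a) ⊆ range (query a).inst.m := (scaled a).D_subset (i a)
  rw [filter_mem_eq_inter, inter_eq_right.2 hsub]
  exact (bundle_sum_two_pow hsub).symm

theorem sum {f : α → ℕ → ℕ} (hW : PolySet W) (hf : PolyTime fun p : α × ℕ => f p.1 p.2) :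
    PolyTime (fun a => ∑ j ∈ W a, f a j) :=
  (PolyTime.sumFilter (P := fun a j => j ∈ W a) .projects (hW.fst.mem .snd) hf).congr fun a =>
    by
      rw [filter_mem_eq_inter]
      exact congrArg (∑ j ∈ ·, f a j) (inter_eq_right.2 (hW.subset_range a))

theorem ball {P : α → ℕ → Prop} (hW : PolySet W) (hP : PolyDec fun p : α × ℕ => P p.1 p.2) :
    PolyDec (fun a => ∀ j ∈ W a, P a j) :=
  (PolyDec.ball (P := fun a j => j ∈ W a → P a j) .projects
    ((hW.fst.mem .snd).imp hP)).congr fun a =>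
      ⟨fun h j hj => h j (mem_range.1 (hW.subset_range a hj)) hj, fun h j _ hj => h j hj⟩

theorem bex {P : α → ℕ → Prop} (hW : PolySet W) (hP : PolyDec fun p : α × ℕ => P p.1 p.2) :
    PolyDec (fun a => ∃ j ∈ W a, P a j) :=
  (ball (P := fun a j => ¬P a j) hW hP.not).not.congr fun a => by push Not; rfl

theorem subset (hV : PolySet V) (hW : PolySet W) : PolyDec (fun a => V a ⊆ W a) :=
  hV.ball (P := fun a j => j ∈ W a) (hW.fst.mem .snd)

theorem card (hW : PolySet W) : Unary (fun a => #(W a)) :=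
  .of_le ((hW.sum (f := fun _ _ => 1) (.const 1)).congr fun _ => (card_eq_sum_ones _).symm)
    Unary.projects.2 fun a => (card_le_card (hW.subset_range a)).trans_eq (card_range _)

theorem nonempty (hW : PolySet W) : PolyDec (fun a => (W a).Nonempty) :=
  (PolyDec.lt (.const 0) hW.card.1).congr fun _ => card_pos

theorem cost (hW : PolySet W) : PolyTime (fun a => (scaled a).cost (W a)) :=
  hW.sum (.C (α := α × ℕ) .snd)

theorem value (hW : PolySet W) : PolyTime (fun a => (scaled a).value (W a)) :=
  .sumFilter .agents ((D (α := α × ℕ) .snd).subset hW.fst) (.Z (α := α × ℕ) .snd)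

theorem budget (hW : PolySet W) : PolyTime (fun a => (scaled a).budget (W a)) :=
  .sumFilter .agents ((D (α := α × ℕ) .snd).subset hW.fst) (.β (α := α × ℕ) .snd)

theorem fundable (hW : PolySet W) : PolyDec (fun a => (scaled a).Fundable (W a)) :=
  .le hW.cost hW.budget

theorem welfare (hW : PolySet W) : PolyTime (fun a => (scaled a).welfare (W a)) :=
  hW.value.sub hW.cost

theorem sum_properlySatisfied {f : α → ℕ → ℕ} (hW : PolySet W)
    (hf : PolyTime fun p : α × ℕ => f p.1 p.2) :
    PolyTime (fun a => ∑ i ∈ (scaled a).properlySatisfied (W a), f a i) :=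
  .sumFilter .agents ((D (α := α × ℕ) .snd).nonempty.and ((D (α := α × ℕ) .snd).subset hW.fst)) hf

end PolySet

end RAM

namespace RAM

open Ctx Finset IntegralInstance

variable {α : Type} [Ctx α] {i j g q t B X : α → ℕ}

theorem Unary.rank (hi : Unary i) : Unary (fun a => (scaled a).rank (i a)) :=
  ((PolySet.D hi.1).card.mul .agents).add hi

theorem Unary.cols : Unary (fun a : α => (scheduled a (g a)).cols) :=
  ((agents.mul agents).mul .accuracy).add (.const 1)

namespace PolyTime

theorem key (hj : PolyTime j) : PolyTime (fun a => (scaled a).key (j a)) :=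
  .sumFilter .agents (.mem_D (α := α × ℕ) .snd hj.fst) (.two_pow (.rank .snd))

theorem properValue (hi : PolyTime i) : PolyTime (fun a => (scaled a).properValue (i a)) :=
  (PolySet.D hi).sum_properlySatisfied (.Z (α := α × ℕ) .snd)

theorem properBudget (hi : PolyTime i) : PolyTime (fun a => (scaled a).properBudget (i a)) :=
  (PolySet.D hi).sum_properlySatisfied (.β (α := α × ℕ) .snd)

theorem gain (hi : PolyTime i) : PolyTime (fun a => (scaled a).gain (i a)) :=
  (properValue hi).sub (PolySet.D hi).cost

theorem weight (hg : PolyTime g) (hi : PolyTime i) :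
    PolyTime (fun a => (scheduled a (g a)).weight (i a)) :=
  (((gain hi).mul Unary.agents.1).mul Unary.accuracy.1).div (gain hg)

theorem credit (hi : PolyTime i) : PolyTime (fun a => (scheduled a (g a)).credit (i a)) :=
  ((properBudget hi).mul (.two_pow .projects)).add
    ((PolySet.D hi).sum (f := fun _ j => 2 ^ j) (.two_pow .snd))

theorem debit (hi : PolyTime i) : PolyTime (fun a => (scheduled a (g a)).debit (i a)) :=
  (PolySet.D hi).cost.mul (.two_pow .projects)

theorem start : PolyTime (fun a : α => (scheduled a (g a)).start) :=
  ((sum (f := fun a i => (scaled a).cost ((scaled a).D i)) .agents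
    (PolySet.D (α := α × ℕ) .snd).cost).add (.const 1)).mul (.two_pow .projects)

end PolyTime

theorem Unary.lo (hi : PolyTime i) : Unary (fun a => (scheduled a (g a)).lo (i a)) := by
  have hlt : PolyDec fun p : (α × ℕ) × ℕ => (scaled p.1.1).key p.1.2 < (scaled p.1.1).key p.2 :=
    .lt (.key (α := (α × ℕ) × ℕ) (.fst .snd)) (.key (α := (α × ℕ) × ℕ) .snd)
  have hbefore : PolyDec fun p : α × ℕ => ∀ y ∈ (scaled p.1).D (i p.1),
      (scaled p.1).key p.2 < (scaled p.1).key y := (PolySet.D hi).fst.ball hlt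
  exact .cardFilter .projects hbefore

theorem Unary.hi (hi : PolyTime i) : Unary (fun a => (scheduled a (g a)).hi (i a)) := by
  have hle : PolyDec fun p : (α × ℕ) × ℕ => (scaled p.1.1).key p.1.2 ≤ (scaled p.1.1).key p.2 :=
    .le (.key (α := (α × ℕ) × ℕ) (.fst .snd)) (.key (α := (α × ℕ) × ℕ) .snd)
  have hupTo : PolyDec fun p : α × ℕ => ∃ y ∈ (scaled p.1).D (i p.1),
      (scaled p.1).key p.2 ≤ (scaled p.1).key y := (PolySet.D hi).fst.bex hle
  exact .cardFilter .projects hupTo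

theorem PolyDec.profitable (hg : PolyTime g) (hi : PolyTime i) :
    PolyDec (fun a => (scaled a).cost ((scaled a).D (i a)) < (scaled a).properValue (i a) ∧
      (scaled a).gain (i a) ≤ (scaled a).gain (g a)) :=
  (lt (PolySet.D hi).cost (.properValue hi)).and (le (.gain hi) (.gain hg))

theorem PolyTime.entry (hg : PolyTime g) (ht : Unary t) (hB : PolyTime B) (hX : PolyTime X) :
    PolyTime (fun a => (scheduled a (g a)).entry (t a) (RAM.digit (B a) (X a))) := by
  have hmod : Unary fun a => t a % (scheduled a (g a)).cols :=
    .of_le (ht.1.mod Unary.cols.1) ht.2 fun _ => Nat.mod_le ..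
  have hweight : PolyTime fun p : α × ℕ => (scheduled p.1 (g p.1)).weight p.2 :=
    .weight (α := α × ℕ) hg.fst .snd
  have hcredit : PolyTime fun p : α × ℕ => (scheduled p.1 (g p.1)).credit p.2 :=
    .credit (α := α × ℕ) (g := fun p => g p.1) .snd
  have hdebit : PolyTime fun p : α × ℕ => (scheduled p.1 (g p.1)).debit p.2 :=
    .debit (α := α × ℕ) (g := fun p => g p.1) .snd
  have hlo : Unary fun p : α × ℕ => (scheduled p.1 (g p.1)).lo p.2 :=
    .lo (α := α × ℕ) (g := fun p => g p.1) .snd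
  have hhi : PolyDec fun p : α × ℕ =>
      (scheduled p.1 (g p.1)).hi p.2 = t p.1 / (scheduled p.1 (g p.1)).cols :=
    .eq (Unary.hi (α := α × ℕ) (g := fun p => g p.1) .snd).1 (ht.1.div Unary.cols.1).fst
  have hcols : Unary fun p : α × ℕ => (scheduled p.1 (g p.1)).cols :=
    (Unary.cols (g := g)).fst
  have hprev : PolyTime fun p : α × ℕ => RAM.digit (B p.1) (X p.1)
      ((scheduled p.1 (g p.1)).lo p.2 * (scheduled p.1 (g p.1)).cols +
        (t p.1 % (scheduled p.1 (g p.1)).cols - (scheduled p.1 (g p.1)).weight p.2)) :=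
    .digit hB.fst hX.fst <| (hlo.mul hcols).add <|
      .of_le (hmod.fst.1.sub hweight) hmod.fst.2 fun _ => Nat.sub_le ..
  have hjob : PolyDec fun p : α × ℕ =>
      (scaled p.1).cost ((scaled p.1).D p.2) < (scaled p.1).properValue p.2 ∧
        (scaled p.1).gain p.2 ≤ (scaled p.1).gain (g p.1) :=
    .profitable (α := α × ℕ) hg.fst .snd
  refine .ite (.lt ht.1 Unary.cols.1) (.ite (.eq ht.1 (.const 0)) .start (.const 0))
    (.max (.digit hB hX (.of_le (ht.1.sub Unary.cols.1) ht.2 fun _ => Nat.sub_le ..)) ?_)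
  exact (PolyTime.supFilter .agents (hjob.and (hhi.and ((PolyDec.le hweight hmod.fst.1).and
    (PolyDec.eq hprev (.const 0)).not))) ((hprev.add hcredit).sub hdebit)).congr fun a => by
      rw [← filter_filter]
      rfl

theorem PolyTime.table (hg : PolyTime g) (hq : PolyTime q)
    (hqc : ∀ a, q a < (scheduled a (g a)).cols) :
    PolyTime (fun a => (scheduled a (g a)).table (scaled a).m (q a)) := by
  have hcredit : PolyTime fun a => ∑ i ∈ (scheduled a (g a)).jobs, (scheduled a (g a)).credit i :=
    .sumFilter .agents (.profitable hg.fst .snd) (.credit .snd)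
  exact .recTable (g := fun a => (scheduled a (g a)).entry)
    ((Unary.projects.add (.const 1)).mul .cols) (start.add hcredit)
    ((Unary.projects.mul .cols).1.add hq)
    (fun a => by rw [add_mul, one_mul]; exact Nat.add_lt_add_left (hqc a) _)
    (fun B hB => .entry (α := (α × ℕ) × Word) hg.fst.fst (.fst .snd) hB.fst.fst .word)
    fun _ _ _ _ _ hr => IntervalScheduling.entry_le hr

end RAM

namespace RAM

open Ctx Finset IntegralInstance

variable {α : Type} [Ctx α] {i w : α → ℕ}

/-- The function maximized by `argmaxBelow` in the choice of the funded bundle. -/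
def score (a : α) (w : ℕ) : ℕ :=
  if (scaled a).Fundable ((scaled a).bundle w) then
    (scaled a).welfare ((scaled a).bundle w) * 2 ^ (scaled a).m + w else 0

theorem PolyTime.score (hw : PolyTime w) : PolyTime (fun a => score a (w a)) :=
  .ite (PolySet.bundle hw).fundable
    (((PolySet.bundle hw).welfare.mul (.two_pow .projects)).add hw) (.const 0)

theorem sup_candidates (a : α) (f : ℕ → ℕ) :
    ((scaled a).candidates (query a).acc).sup f = max (f 0) ((range (scaled a).n).sup fun g =>
      (range (scheduled a g).cols).sup fun q =>
        f ((scheduled a g).table (scaled a).m (q % (scheduled a g).cols) % 2 ^ (scaled a).m)) := by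
  rw [candidates, sup_insert, sup_image, sup_product_left]
  refine congrArg (max (f 0)) (sup_congr rfl fun g _ => sup_congr rfl fun q hq => ?_)
  rw [Nat.mod_eq_of_lt (b := (scheduled a g).cols) (mem_range.1 hq)]
  rfl

theorem PolyTime.sup_score_candidates : PolyTime fun a : α =>
    ((scaled a).candidates (query a).acc).sup (RAM.score a) := by
  have htable : PolyTime fun p : (α × ℕ) × ℕ => (scheduled p.1.1 p.1.2).table (scaled p.1.1).m
      (p.2 % (scheduled p.1.1 p.1.2).cols) % 2 ^ (scaled p.1.1).m :=
    (PolyTime.table (α := (α × ℕ) × ℕ) (.fst .snd) (PolyTime.snd.mod Unary.cols.1)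
      fun _ => Nat.mod_lt _ (Nat.succ_pos _)).mod (.two_pow .projects)
  have hsup : PolyTime fun p : α × ℕ => (range (scheduled p.1 p.2).cols).sup fun q =>
      RAM.score p.1 ((scheduled p.1 p.2).table (scaled p.1).m
        (q % (scheduled p.1 p.2).cols) % 2 ^ (scaled p.1).m) :=
    .sup .cols (.score htable)
  exact ((PolyTime.score (.const 0)).max (.sup .agents hsup)).congr fun a =>
    (sup_candidates a _).symm

theorem PolySet.funded : PolySet fun a : α => (scaled a).funded (query a).acc := by
  refine .bundle ((PolyTime.sup_score_candidates.mod (.two_pow .projects)).congr fun a => ?_)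
  rw [argmaxBelow]
  congr 1
  unfold score
  rw [sup_ite]
  simp

theorem PolyTime.offer (hi : PolyTime i) : PolyTime (fun a =>
    if (scaled a).D (i a) ⊆ (scaled a).funded (query a).acc then (scaled a).β (i a) else 0) :=
  .ite ((PolySet.D hi).subset .funded) (.β hi) (.const 0)

theorem PolyTime.payment (hi : Unary i) :
    PolyTime (fun a => (scaled a).payment (query a).acc (i a)) :=
  (offer hi.1).min (PolySet.funded.cost.sub (.sum (f := fun a i =>
    if (scaled a).D i ⊆ (scaled a).funded (query a).acc then (scaled a).β i else 0) hi
      (.offer (α := α × ℕ) .snd)))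

theorem isOutput_outcome {I : SingleMinded} {k : ℕ} {s : Store}
    (hset : ∀ j < I.m, s.arr 7 j = if j ∈ I.toIntegral.funded k then 1 else 0)
    (hpay : ∀ i < I.n, s.arr 8 i = I.toIntegral.payment k i)
    (hden : ∀ i < I.n, s.arr 9 i = I.commonDen) : I.IsOutput s (I.outcome k) := by
  refine ⟨fun j => ?_, fun i => ⟨?_, ?_⟩⟩
  · rw [hset j j.2, ite_ne_right_iff, and_iff_left one_ne_zero]
    exact mem_filter_univ j
  · exact hden i i.2 ▸ SingleMinded.commonDen_pos.ne'
  · rw [hpay i i.2, hden i i.2]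
    rfl

theorem exists_program : ∃ p K, ∀ q : Query, RunsTo p q.input ((q.inst.size + q.acc + 2) ^ K)
    fun s => q.inst.IsOutput s (q.inst.outcome q.acc) := by
  obtain ⟨p₁, T₁, hT₁, h₁⟩ := PolyTime.fill (α := Query) (l := []) (A := 7) .projects
    (f := fun q j => if j ∈ (scaled q).funded (query q).acc then 1 else 0)
    (.ite (PolySet.funded.fst.mem .snd) (.const 1) (.const 0)) (by omega) le_rfl (by simp)
  obtain ⟨p₂, T₂, hT₂, h₂⟩ := PolyTime.fill (α := Query) (l := []) (A := 8) .agents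
    (f := fun q i => (scaled q).payment (query q).acc i)
    (.payment (α := Query × ℕ) .snd) (by omega) le_rfl (by simp)
  obtain ⟨p₃, T₃, hT₃, h₃⟩ := PolyTime.fill (α := Query) (l := []) (A := 9) .agents
    (f := fun q _ => (query q).inst.commonDen) (.fst .commonDen) (by omega) le_rfl (by simp)
  obtain ⟨K, hK⟩ := hT₁.add (hT₂.add hT₃)
  refine ⟨.seq p₁ (.seq p₂ p₃), K, fun q => RunsTo.mono ?_ (hK q) fun _ h => h⟩
  have hinput : Holds [] q.input q := ⟨fun _ _ => rfl, fun _ _ => rfl, rfl⟩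
  refine (h₁ q _ hinput).seq fun s₁ ⟨hs₁, hset, _⟩ =>
    (h₂ q s₁ hs₁).seq fun s₂ ⟨hs₂, hpay, hkeep₂⟩ =>
      (h₃ q s₂ hs₂).mono le_rfl fun s₃ ⟨_, hden, hkeep₃⟩ => isOutput_outcome ?_ ?_ hden
  · rwa [hkeep₃ 7 (by decide), hkeep₂ 7 (by decide)]
  · rwa [hkeep₃ 8 (by decide)]

end RAM

theorem add_ceil_add_two_pow_le (l K : ℕ) {x : ℝ} (hx : 0 ≤ x) :
    ((l + ⌈x⌉₊ + 2) ^ K : ℝ) ≤ 3 ^ K * (l + x + 1) ^ K := by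
  rw [← mul_pow]
  have := Nat.ceil_lt_add_one hx
  have : (0 : ℝ) ≤ l := l.cast_nonneg
  exact pow_le_pow_left₀ (by positivity) (by linarith) K

theorem mainTheorem1 :
    ∃ (A : RAM.Cmd) (c d : ℕ),
      ∀ I : SingleMinded, I.Laminar → ∀ ε : ℝ, 0 < ε →
        ∃ (t : ℕ) (s : RAM.Store) (o : PBOutcome I.n I.m),
          RAM.Exec A (I.input ⌈1 / ε⌉₊) t s ∧
          (t : ℝ) ≤ c * ((I.size : ℝ) + 1 / ε + 1) ^ d ∧
          I.IsOutput s o ∧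
          I.toInstance.Feasible o ∧
          I.toInstance.WP o ∧
          ∃ opt : PBOutcome I.n I.m,
            I.toInstance.IsUWOWP opt ∧
            (1 - ε) * I.toInstance.SW opt ≤ I.toInstance.SW o := by
  obtain ⟨A, K, hA⟩ := RAM.exists_program
  refine ⟨A, 3 ^ K, K, fun I hI ε hε => ?_⟩
  obtain ⟨t, s, hexec, ht, hout⟩ := hA ⟨I, ⌈1 / ε⌉₊⟩
  obtain ⟨hfeasible, hWP, -⟩ := SingleMinded.feasible_wp_SW_outcome (I := I) (k := ⌈1 / ε⌉₊)
  refine ⟨t, s, I.outcome ⌈1 / ε⌉₊, hexec, ?_, hout, hfeasible, hWP,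
    SingleMinded.exists_isUWOWP_le_SW_outcome hI hε (Nat.le_ceil _)⟩
  calc (t : ℝ) ≤ (I.size + ⌈1 / ε⌉₊ + 2) ^ K := by exact_mod_cast ht
    _ ≤ 3 ^ K * (I.size + 1 / ε + 1) ^ K := add_ceil_add_two_pow_le _ _ (by positivity)
    _ = (3 ^ K : ℕ) * (I.size + 1 / ε + 1) ^ K := by rw [Nat.cast_pow, Nat.cast_ofNat]
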